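/- There are a single algorithm and a constant $c$ such that the following holds. Given a semi-complete digraph $T$ on $n$ vertices (a loopless digraph without parallel arcs in which, for every two distinct vertices $v,w$, at least one of the arcs $(v,w)$, $(w,v)$ is present; both may be present) and a nonnegative integer $k$, the algorithm halts in time at most $$c\cdot \exp\!\big(C\sqrt{2k}\big)\cdot (n+1)^{c},\qquad C=\pi\sqrt{\tfrac{2}{3}},$$ that is, in time $\exp(C\sqrt{2k})\cdot n^{O(1)}$, and either outputs a feedback arc set of $T$ of size at most $k$ (a set $F\subseteq E(T)$ with $|F|\le k$ such that $T\setminus F$ has no directed cycle), or correctly reports that no such set exists. Here an algorithm is a program of a random access machine with indirect addressing, addition and truncated subtraction of natural numbers; $T$ is given by its adjacency matrix, and running time is measured by the logarithmic cost criterion (every operation and every test costs one unit plus the bit lengths of the numbers and memory addresses that it handles). -/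

import Mathlib

/-! ## Digraphs -/

namespace Digraph

/-- A simple digraph (no loops; parallel arcs cannot be expressed, opposite arcs may coexist) is
semi-complete if any two distinct vertices are joined by an arc in at least one direction. -/
structure IsSemicomplete {V : Type*} (T : Digraph V) : Prop where
  loopless : ∀ v, ¬ T.Adj v v
  adj_or_adj : ∀ v w, v ≠ w → T.Adj v w ∨ T.Adj w v

/-- A digraph is acyclic if no nonempty directed walk returns to its starting vertex. -/
def IsAcyclic {V : Type*} (T : Digraph V) : Prop :=
  ∀ v, ¬ Relation.TransGen T.Adj v v

/-- The digraph `T` with the arcs in `F` removed. -/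
def deleteArcs {V : Type*} (T : Digraph V) (F : Finset (V × V)) : Digraph V where
  Adj v w := T.Adj v w ∧ (v, w) ∉ F

/-- `F` is a feedback arc set of `T`: a set of arcs of `T` whose removal leaves an acyclic
digraph. -/
def IsFeedbackArcSet {V : Type*} (T : Digraph V) (F : Finset (V × V)) : Prop :=
  (∀ e ∈ F, T.Adj e.1 e.2) ∧ (T.deleteArcs F).IsAcyclic

end Digraph

/-! ## Random access machines with logarithmic cost

A machine has registers and a random access memory, all of whose cells hold natural numbers.  A
program mentions only finitely many registers (by fixed numbers), while the memory is addressed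
indirectly, through the contents of registers.  Every elementary operation and every test is
charged one unit plus the bit lengths of all the numbers (operands, stored values, memory
addresses) that it handles. -/

namespace RAM

/-- A memory state of the machine. -/
structure State where
  reg : ℕ → ℕ
  mem : ℕ → ℕ

/-- Elementary operations; all arguments except the second one of `const` are register numbers. -/
inductive Instr where
  /-- `r_d := c` -/
  | const (d c : ℕ)
  /-- `r_d := r_a` -/
  | copy (d a : ℕ)
  /-- `r_d := r_a + r_b` -/
  | add (d a b : ℕ)
  /-- `r_d := max (r_a - r_b) 0` -/
  | sub (d a b : ℕ)
  /-- `r_d := mem[r_a]` -/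
  | load (d a : ℕ)
  /-- `mem[r_a] := r_b` -/
  | store (a b : ℕ)

/-- The bit length of a natural number, where `0` has length `1`. -/
def len (x : ℕ) : ℕ := Nat.log 2 x + 1

/-- The effect of an elementary operation. -/
def Instr.exec : Instr → State → State
  | .const d c, s => { s with reg := Function.update s.reg d c }
  | .copy d a, s => { s with reg := Function.update s.reg d (s.reg a) }
  | .add d a b, s => { s with reg := Function.update s.reg d (s.reg a + s.reg b) }
  | .sub d a b, s => { s with reg := Function.update s.reg d (s.reg a - s.reg b) }
  | .load d a, s => { s with reg := Function.update s.reg d (s.mem (s.reg a)) }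
  | .store a b, s => { s with mem := Function.update s.mem (s.reg a) (s.reg b) }

/-- The logarithmic cost of an elementary operation. -/
def Instr.cost : Instr → State → ℕ
  | .const _ c, _ => 1 + len c
  | .copy _ a, s => 1 + len (s.reg a)
  | .add _ a b, s => 1 + len (s.reg a) + len (s.reg b)
  | .sub _ a b, s => 1 + len (s.reg a) + len (s.reg b)
  | .load _ a, s => 1 + len (s.reg a) + len (s.mem (s.reg a))
  | .store a b, s => 1 + len (s.reg a) + len (s.reg b)

/-- Programs.  The tests of `ite a b p q` (if-then-else) and `loop a b p` (while) are
`r_a < r_b`. -/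
inductive Prog where
  | skip
  | op (i : Instr)
  | seq (p q : Prog)
  | ite (a b : ℕ) (p q : Prog)
  | loop (a b : ℕ) (p : Prog)

/-- The logarithmic cost of the test `r_a < r_b`. -/
def testCost (a b : ℕ) (s : State) : ℕ := 1 + len (s.reg a) + len (s.reg b)

/-- `Run p s s' t`: the program `p`, started in the state `s`, halts in the state `s'` after
time `t`. -/
inductive Run : Prog → State → State → ℕ → Prop where
  | skip (s : State) : Run .skip s s 1
  | op (i : Instr) (s : State) : Run (.op i) s (i.exec s) (i.cost s)
  | seq {p q : Prog} {s₁ s₂ s₃ : State} {t u : ℕ} :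
      Run p s₁ s₂ t → Run q s₂ s₃ u → Run (.seq p q) s₁ s₃ (t + u)
  | ite_true {a b : ℕ} {p q : Prog} {s s' : State} {t : ℕ} :
      s.reg a < s.reg b → Run p s s' t → Run (.ite a b p q) s s' (testCost a b s + t)
  | ite_false {a b : ℕ} {p q : Prog} {s s' : State} {t : ℕ} :
      ¬ s.reg a < s.reg b → Run q s s' t → Run (.ite a b p q) s s' (testCost a b s + t)
  | loop_true {a b : ℕ} {p : Prog} {s₁ s₂ s₃ : State} {t u : ℕ} :
      s₁.reg a < s₁.reg b → Run p s₁ s₂ t → Run (.loop a b p) s₂ s₃ u →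
        Run (.loop a b p) s₁ s₃ (testCost a b s₁ + t + u)
  | loop_false {a b : ℕ} {p : Prog} {s : State} :
      ¬ s.reg a < s.reg b → Run (.loop a b p) s s (testCost a b s)

/-! ## Input and output -/

open Classical in
/-- The initial state for the input `(T, k)`: register `0` holds the number `n` of vertices,
register `1` holds `k`, the cell `i * n + j` of the memory holds the entry `(i, j)` of the
adjacency matrix of `T`, and everything else is `0`. -/
noncomputable def input {n : ℕ} (T : Digraph (Fin n)) (k : ℕ) : State where
  reg r := if r = 0 then n else if r = 1 then k else 0
  mem a := if ∃ i j : Fin n, a = (i : ℕ) * n + (j : ℕ) ∧ T.Adj i j then 1 else 0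

/-- The set of pairs of vertices whose 0-1 matrix is stored in the first `n * n` memory cells. -/
def outputArcs (n : ℕ) (s : State) : Finset (Fin n × Fin n) :=
  {e | s.mem ((e.1 : ℕ) * n + (e.2 : ℕ)) = 1}

/-- The final state `s` answers the input `(T, k)`: either register `0` holds `1` and the memory
holds a feedback arc set of `T` of size at most `k`, or register `0` holds `0` and `T` has no
feedback arc set of size at most `k`. -/
def Answers {n : ℕ} (T : Digraph (Fin n)) (k : ℕ) (s : State) : Prop :=
  (s.reg 0 = 1 ∧ T.IsFeedbackArcSet (outputArcs n s) ∧ (outputArcs n s).card ≤ k) ∨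
    (s.reg 0 = 0 ∧ ¬ ∃ F : Finset (Fin n × Fin n), T.IsFeedbackArcSet F ∧ F.card ≤ k)

end RAM

/-! ## Running times of bounded computations -/

namespace RAM

/-! A feedback arc set of size at most `k` exists iff the vertices can be ordered with at most `k`
backward arcs. The least number of backward arcs obeys a recursion over initial segments: if `v`
comes last in `X`, every arc into `v` from outside `X` goes backwards, so the cost of `X` is that of
`X` without `v` plus `inArcs a m v X`. The program runs this recursion only over the cheap sets,
those of cost at most `k`.

The point is that cheap sets are few once some ordering with at most `k` backward arcs exists. Fix
such an ordering and a cheap set `S`. In a semi-complete digraph, a pair consisting of `v ∉ S` and a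
later `w ∈ S` carries the backward arc `(w, v)` or the arc `(v, w)` entering `S`. There are at most
`k` arcs of each kind (`Cost.cut_le`), so `S` has at most `2 * k` inversions (`inversions_le`).
Weighting sets of size `j` by `q ^ inversions` gives a Gaussian binomial coefficient, bounded by a
partition generating function (`sum_powersetCard_pow_inversions_le`), which at `q = exp (-t)` is at
most `exp (π² / (6t))` (`prod_inv_one_sub_pow_le`). Optimizing `t` yields `Listed.length_le_exp`.

No good ordering is known in advance, so vertices are added one at a time. Cheap sets restrict to
cheap sets (`Cost.restrict`), hence those of the next stage lie among the old ones with or without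
the new vertex (`Listed.candidates`). If the full vertex set of a stage is not cheap, the answer is
no; otherwise the counting bound applies to its list. Thus every stage that is entered has a short
list to start from (`reaches_stages`).

Correctness of a negative answer rests on `cost_of_closed`, which turns a feedback arc set into an
ordering; a positive answer is produced by tracing the recursion back (`reaches_outputProg`). Sets
are bit masks that address a table of `2 ^ n` cells. All cells start as `0`, the code for "too
expensive", so the table needs no initialization, and addresses have only `O(n)` bits. Running times
are handled by a Hoare-style judgement `Reaches` that counts elementary steps while all numbers stay
below a fixed bound. -/

theorem len_mono {a b : ℕ} (h : a ≤ b) : len a ≤ len b :=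
  Nat.add_le_add_right (Nat.log_mono_right h) 1

/-- All numbers stored in the state are at most `B`. -/
structure Bounded (B : ℕ) (s : State) : Prop where
  reg : ∀ r, s.reg r ≤ B
  mem : ∀ a, s.mem a ≤ B

/-- The result of the operation is at most `B` if the state is bounded by `B`. -/
def Instr.Fits (B : ℕ) : Instr → State → Prop
  | .const _ c, _ => c ≤ B
  | .add _ a b, s => s.reg a + s.reg b ≤ B
  | _, _ => True

theorem update_le {B : ℕ} {f : ℕ → ℕ} (hf : ∀ r, f r ≤ B) {d x : ℕ} (hx : x ≤ B) (r : ℕ) :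
    Function.update f d x r ≤ B := by
  rw [Function.update_apply]
  split_ifs
  · exact hx
  · exact hf r

theorem Bounded.exec {B : ℕ} {s : State} (h : Bounded B s) {i : Instr} (hi : i.Fits B s) :
    Bounded B (i.exec s) := by
  cases i with
  | const d c => exact ⟨update_le h.reg hi, h.mem⟩
  | copy d a => exact ⟨update_le h.reg (h.reg a), h.mem⟩
  | add d a b => exact ⟨update_le h.reg hi, h.mem⟩
  | sub d a b => exact ⟨update_le h.reg ((Nat.sub_le _ _).trans (h.reg a)), h.mem⟩
  | load d a => exact ⟨update_le h.reg (h.mem _), h.mem⟩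
  | store a b => exact ⟨h.reg, update_le h.mem (h.reg b)⟩

theorem Bounded.cost_le {B : ℕ} {s : State} (h : Bounded B s) {i : Instr} (hi : i.Fits B s) :
    i.cost s ≤ 2 * len B + 1 := by
  have hr := fun r => len_mono (h.reg r)
  have hm := fun a => len_mono (h.mem a)
  cases i with
  | const d c => have := len_mono (show c ≤ B from hi); simp only [Instr.cost]; omega
  | copy d a => have := hr a; simp only [Instr.cost]; omega
  | add d a b => have := hr a; have := hr b; simp only [Instr.cost]; omega
  | sub d a b => have := hr a; have := hr b; simp only [Instr.cost]; omega
  | load d a => have := hr a; have := hm (s.reg a); simp only [Instr.cost]; omega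
  | store a b => have := hr a; have := hr b; simp only [Instr.cost]; omega

theorem Bounded.testCost_le {B : ℕ} {s : State} (h : Bounded B s) (a b : ℕ) :
    testCost a b s ≤ 2 * len B + 1 := by
  have := len_mono (h.reg a)
  have := len_mono (h.reg b)
  simp only [testCost]; omega

/-- Started in `s`, if bounded by `B`, the program `p` halts after at most `t` elementary steps in
a state that satisfies `Q`, and all numbers stay bounded by `B`. -/
def Reaches (B : ℕ) (p : Prog) (s : State) (t : ℕ) (Q : State → Prop) : Prop :=
  Bounded B s → ∃ s' u, Run p s s' u ∧ u ≤ t * (2 * len B + 1) ∧ Bounded B s' ∧ Q s'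

variable {B : ℕ} {p q : Prog} {s : State} {t u : ℕ} {Q R : State → Prop}

theorem Reaches.mono (h : Reaches B p s t R) (ht : t ≤ u) (hQ : ∀ s', R s' → Q s') :
    Reaches B p s u Q := by
  intro hs
  obtain ⟨s', x, h1, h2, h3, h4⟩ := h hs
  exact ⟨s', x, h1, h2.trans (Nat.mul_le_mul_right _ ht), h3, hQ _ h4⟩

theorem Reaches.skip (h : Q s) : Reaches B .skip s 1 Q :=
  fun hs => ⟨s, 1, .skip s, by omega, hs, h⟩

theorem Reaches.seq (hp : Reaches B p s t R) (hq : ∀ s', R s' → Reaches B q s' u Q) :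
    Reaches B (.seq p q) s (t + u) Q := by
  intro hs
  obtain ⟨s', x, h1, h2, h3, h4⟩ := hp hs
  obtain ⟨s'', y, g1, g2, g3, g4⟩ := hq s' h4 h3
  exact ⟨s'', x + y, .seq h1 g1, by rw [add_mul]; omega, g3, g4⟩

theorem Reaches.ite {a b : ℕ} (h1 : s.reg a < s.reg b → Reaches B p s t Q)
    (h2 : s.reg b ≤ s.reg a → Reaches B q s t Q) : Reaches B (.ite a b p q) s (t + 1) Q := by
  intro hs
  have hc := hs.testCost_le a b
  by_cases hab : s.reg a < s.reg b
  · obtain ⟨s', x, g1, g2, g3, g4⟩ := h1 hab hs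
    exact ⟨s', _, .ite_true hab g1, by rw [add_mul]; omega, g3, g4⟩
  · obtain ⟨s', x, g1, g2, g3, g4⟩ := h2 (not_lt.mp hab) hs
    exact ⟨s', _, .ite_false hab g1, by rw [add_mul]; omega, g3, g4⟩

/-- While rule: `I i s` says that the invariant holds and at most `i` rounds remain. -/
theorem Reaches.loop {a b : ℕ} (I : ℕ → State → Prop) (τ : ℕ)
    (hI : ∀ i s, I i s → s.reg a < s.reg b → ∃ j, i = j + 1 ∧ Reaches B p s τ (I j))
    (hQ : ∀ i s, I i s → s.reg b ≤ s.reg a → Q s) (N : ℕ) :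
    ∀ s, I N s → Reaches B (.loop a b p) s (N * (τ + 1) + 1) Q := by
  induction N with
  | zero =>
    intro s h hs
    have hab : ¬ s.reg a < s.reg b := fun hab => by
      obtain ⟨j, hj, -⟩ := hI 0 s h hab; omega
    exact ⟨s, _, .loop_false hab, by simpa using hs.testCost_le a b, hs, hQ 0 s h (not_lt.mp hab)⟩
  | succ N ih =>
    intro s h hs
    have hc := hs.testCost_le a b
    by_cases hab : s.reg a < s.reg b
    · obtain ⟨j, hj, hp⟩ := hI _ s h hab
      obtain rfl : N = j := by omega
      obtain ⟨s', x, h1, h2, h3, h4⟩ := hp hs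
      obtain ⟨s'', y, g1, g2, g3, g4⟩ := ih s' h4 h3
      refine ⟨s'', _, .loop_true hab h1 g1, ?_, g3, g4⟩
      have : ((N + 1) * (τ + 1) + 1) * (2 * len B + 1)
          = (N * (τ + 1) + 1) * (2 * len B + 1) + τ * (2 * len B + 1) + (2 * len B + 1) := by ring
      omega
    · refine ⟨s, _, .loop_false hab, ?_, hs, hQ _ s h (not_lt.mp hab)⟩
      rw [add_mul]; omega

/-- Straight-line code. -/
def ops : List Instr → Prog
  | [] => .skip
  | i :: l => .seq (.op i) (ops l)

/-- The effect of straight-line code. -/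
def execs : List Instr → State → State
  | [], s => s
  | i :: l, s => execs l (i.exec s)

/-- All intermediate results of straight-line code are at most `B`. -/
def FitsAll (B : ℕ) : List Instr → State → Prop
  | [], _ => True
  | i :: l, s => i.Fits B s ∧ FitsAll B l (i.exec s)

theorem Reaches.ops : ∀ {l : List Instr} {s : State}, FitsAll B l s → Q (execs l s) →
    Reaches B (ops l) s (l.length + 1) Q
  | [], _, _, hQ => Reaches.skip hQ
  | i :: l, s, hl, hQ => by
    have : Reaches B (.op i) s 1 (fun s' => s' = i.exec s) := fun hs =>
      ⟨_, _, .op i s, by simpa using hs.cost_le hl.1, hs.exec hl.1, rfl⟩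
    refine (this.seq (u := l.length + 1) ?_).mono (by simp; omega) fun _ h => h
    rintro _ rfl
    exact Reaches.ops hl.2 hQ

end RAM

/-! ## Sets of vertices as bit masks -/

/-- In `X = 2 ^ v + Y` bit `v` of `Y` is clear, so the addition produces no carry and no other bit
differs between `X` and `Y`. Subtraction therefore removes an element from the coded set. -/
theorem Nat.testBit_sub_two_pow {X v : ℕ} (h : X.testBit v = true) (w : ℕ) :
    (X - 2 ^ v).testBit w = (X.testBit w && decide (w ≠ v)) := by
  have hle := Nat.ge_two_pow_of_testBit h
  obtain ⟨Y, rfl⟩ := Nat.exists_eq_add_of_le hle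
  rw [Nat.add_sub_cancel_left]
  have hv : Y.testBit v = false := by
    rw [Nat.testBit_two_pow_add_eq] at h; simpa using h
  rcases lt_trichotomy w v with hw | rfl | hw
  · rw [Nat.testBit_two_pow_add_gt hw]; simp [hw.ne]
  · simp [hv]
  · obtain ⟨j, rfl⟩ := Nat.exists_eq_add_of_lt hw
    have h1 : (2 ^ v + Y) / 2 ^ v = Y / 2 ^ v + 1 := by
      rw [Nat.add_comm, Nat.add_div_right _ (by positivity)]
    have h2 : Y / 2 ^ v % 2 = 0 := by
      rw [Nat.testBit_eq_decide_div_mod_eq] at hv; simpa using hv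
    have h3 : (2 ^ v + Y) / 2 ^ (v + 1) = Y / 2 ^ (v + 1) := by
      rw [pow_succ, ← Nat.div_div_eq_div_mul, ← Nat.div_div_eq_div_mul, h1]; omega
    have h4 : v + j + 1 = (v + 1) + j := by omega
    rw [h4, Nat.add_comm (v + 1) j, ← Nat.testBit_div_two_pow, ← Nat.testBit_div_two_pow, h3]
    have : j + (v + 1) ≠ v := by omega
    simp [this]

theorem Nat.mod_two_pow_succ_of_testBit {X v : ℕ} (h : X.testBit v = true) :
    X % 2 ^ (v + 1) = X % 2 ^ v + 2 ^ v := by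
  rw [Nat.testBit_eq_decide_div_mod_eq] at h
  rw [pow_succ, Nat.mod_mul, of_decide_eq_true h, mul_one]

theorem Nat.mod_two_pow_succ_of_not_testBit {X v : ℕ} (h : X.testBit v = false) :
    X % 2 ^ (v + 1) = X % 2 ^ v := by
  rw [Nat.testBit_eq_decide_div_mod_eq] at h
  have : X / 2 ^ v % 2 = 0 := by simpa using h
  rw [pow_succ, Nat.mod_mul, this, mul_zero, add_zero]

/-- This is how a machine without division reads bits: scanning from the top with `X % 2 ^ (v + 1)`
in a register, one comparison with `2 ^ v` decides the bit, and a subtraction, if it is set, leaves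
the next remainder. -/
theorem Nat.testBit_iff_two_pow_le_mod {X v : ℕ} :
    X.testBit v = true ↔ 2 ^ v ≤ X % 2 ^ (v + 1) := by
  have hp : X % 2 ^ v < 2 ^ v := Nat.mod_lt _ (by positivity)
  cases h : X.testBit v
  · rw [Nat.mod_two_pow_succ_of_not_testBit h]; simp [hp]
  · rw [Nat.mod_two_pow_succ_of_testBit h]; simp

theorem Nat.lt_of_testBit_of_lt {X v m : ℕ} (h : X.testBit v = true) (hX : X < 2 ^ m) : v < m := by
  have := (Nat.ge_two_pow_of_testBit h).trans_lt hX
  exact (Nat.pow_lt_pow_iff_right (by norm_num)).mp this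

/-! ## The cost of vertex orderings -/

namespace FeedbackArcs

/-- The number of `y < m` outside the set with mask `X` such that `a y v = 1`, for a 0-1
matrix `a`. -/
def inArcs (a : ℕ → ℕ → ℕ) (m v X : ℕ) : ℕ :=
  ∑ y ∈ Finset.range m, if X.testBit y then 0 else a y v

/-- The set with mask `X` can be ordered in such a way that exactly `c` arcs `(y, v)` with `y < m`
and `v` in the set have a tail `y` that does not precede `v`. -/
inductive Cost (a : ℕ → ℕ → ℕ) (m : ℕ) : ℕ → ℕ → Prop where
  | zero : Cost a m 0 0
  | step {X v c : ℕ} : X.testBit v = true → Cost a m (X - 2 ^ v) c →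
      Cost a m X (c + inArcs a m v X)

/-- The value `x` encodes the least cost of an ordering of the set with mask `X`: it is
`0` if the cost is more than `k`, and otherwise the cost plus one. -/
def IsValue (a : ℕ → ℕ → ℕ) (m k X x : ℕ) : Prop :=
  (x = 0 ∧ ∀ c, Cost a m X c → k < c) ∨
    ∃ c, c ≤ k ∧ x = c + 1 ∧ Cost a m X c ∧ ∀ c', Cost a m X c' → c ≤ c'

/-- The set with mask `X` has an ordering of cost at most `k`. -/
def Cheap (a : ℕ → ℕ → ℕ) (m k X : ℕ) : Prop := ∃ c, c ≤ k ∧ Cost a m X c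

variable {a : ℕ → ℕ → ℕ} {m k X v c x : ℕ}

theorem IsValue.cheap_iff (h : IsValue a m k X x) : Cheap a m k X ↔ 0 < x := by
  rcases h with ⟨rfl, h⟩ | ⟨c, hc, rfl, h1, -⟩
  · refine ⟨fun ⟨c, hc, h'⟩ => ?_, fun h => absurd h (lt_irrefl _)⟩
    exact absurd (h c h') (by omega)
  · exact ⟨fun _ => by omega, fun _ => ⟨c, hc, h1⟩⟩

theorem IsValue.of_not_cheap (h : ¬ Cheap a m k X) : IsValue a m k X 0 :=
  .inl ⟨rfl, fun c hc => by by_contra hk; exact h ⟨c, by omega, hc⟩⟩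

theorem IsValue.le (h : IsValue a m k X x) : x ≤ k + 1 := by
  rcases h with ⟨rfl, -⟩ | ⟨c, hc, rfl, -⟩ <;> omega

theorem Cost.eq_zero (h : Cost a m 0 c) : c = 0 := by
  cases h with
  | zero => rfl
  | step hv => simp at hv

theorem isValue_zero : IsValue a m k 0 1 :=
  .inr ⟨0, Nat.zero_le _, rfl, .zero, fun _ _ => Nat.zero_le _⟩

theorem cheap_zero : Cheap a m k 0 := ⟨0, Nat.zero_le _, .zero⟩

theorem inArcs_mono {m' X' : ℕ} (hm : m ≤ m')
    (hX : ∀ y < m, X'.testBit y = true → X.testBit y = true) :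
    inArcs a m v X ≤ inArcs a m' v X' := by
  unfold inArcs
  calc _ ≤ ∑ y ∈ Finset.range m, if X'.testBit y then 0 else a y v := by
        refine Finset.sum_le_sum fun y hy => ?_
        have := hX y (Finset.mem_range.mp hy)
        split_ifs <;> simp_all
    _ ≤ _ := Finset.sum_le_sum_of_subset (by simpa using hm)

/-- An ordering induces a no more costly ordering of the vertices less than `m`. -/
theorem Cost.restrict (h : Cost a (m + 1) X c) : ∃ c' ≤ c, Cost a m (X % 2 ^ m) c' := by
  induction h with
  | zero => exact ⟨0, le_rfl, by simpa using Cost.zero⟩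
  | @step X v c hv _ ih =>
    obtain ⟨c', hc', ih⟩ := ih
    -- A vertex `v < m` keeps its place and can only lose the incoming arc from `m`; a vertex `v ≥
    -- m` is dropped together with its contribution.
    by_cases hm : v < m
    · have hv' : (X % 2 ^ m).testBit v = true := by simp [hm, hv]
      have heq : (X - 2 ^ v) % 2 ^ m = X % 2 ^ m - 2 ^ v := by
        refine Nat.eq_of_testBit_eq fun i => ?_
        rw [Nat.testBit_sub_two_pow hv', Nat.testBit_mod_two_pow, Nat.testBit_mod_two_pow,
          Nat.testBit_sub_two_pow hv, Bool.and_assoc]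
      rw [heq] at ih
      refine ⟨_, Nat.add_le_add hc' ?_, .step hv' ih⟩
      exact inArcs_mono (Nat.le_succ m) fun y hy hb => by simp [hy, hb]
    · have heq : (X - 2 ^ v) % 2 ^ m = X % 2 ^ m := by
        refine Nat.eq_of_testBit_eq fun i => ?_
        rw [Nat.testBit_mod_two_pow, Nat.testBit_mod_two_pow, Nat.testBit_sub_two_pow hv]
        by_cases hi : i < m
        · have : i ≠ v := by omega
          simp [this]
        · simp [hi]
      rw [heq] at ih
      exact ⟨c', by omega, ih⟩

theorem Cheap.restrict (h : Cheap a (m + 1) k X) : Cheap a m k (X % 2 ^ m) := by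
  obtain ⟨c, hc, h⟩ := h
  obtain ⟨c', hc', h⟩ := h.restrict
  exact ⟨c', hc'.trans hc, h⟩

/-- Its contrapositive justifies aborting as soon as an induced subdigraph on the first vertices has
no ordering of cost at most `k`. -/
theorem Cheap.full_of_le {n : ℕ} (h : m ≤ n) (hn : Cheap a n k (2 ^ n - 1)) :
    Cheap a m k (2 ^ m - 1) := by
  induction n, h using Nat.le_induction with
  | base => exact hn
  | succ n hmn ih =>
    refine ih ?_
    have : (2 ^ (n + 1) - 1) % 2 ^ n = 2 ^ n - 1 :=
      Nat.eq_of_testBit_eq fun i => by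
        simp only [Nat.testBit_mod_two_pow, Nat.testBit_two_pow_sub_one]
        by_cases hi : i < n
        · simp [hi]; omega
        · simp [hi]
    rw [← this]
    exact hn.restrict

/-- `best` is the minimum of `k + 2` and of the numbers `F (X - 2 ^ v) + inArcs a m v X` over the
vertices `v ≥ u` in the set with mask `X` for which `F (X - 2 ^ v)` is positive; unless it is
`k + 2`, it is attained at `bv`. -/
structure IsBest (a : ℕ → ℕ → ℕ) (F : ℕ → ℕ) (m k X u best bv : ℕ) : Prop where
  le : best ≤ k + 2
  le_of_testBit : ∀ v, u ≤ v → X.testBit v = true → 0 < F (X - 2 ^ v) →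
    best ≤ F (X - 2 ^ v) + inArcs a m v X
  attained : best < k + 2 → X.testBit bv = true ∧ 0 < F (X - 2 ^ bv) ∧
    best = F (X - 2 ^ bv) + inArcs a m bv X

/-- One step of the recursion. Encoded values are at most `k + 1`, so `k + 2` serves as infinity,
and the shift by one in `F (X - 2 ^ v)` carries over to `best`. Skipping the `v` with `F (X - 2 ^ v)
= 0` is harmless, since an ordering of `X` ending in such a `v` already costs more than `k`. -/
theorem IsBest.isValue {F : ℕ → ℕ} {best bv : ℕ} (h : IsBest a F m k X 0 best bv) (hX : X ≠ 0)
    (hF : ∀ v, X.testBit v = true → IsValue a m k (X - 2 ^ v) (F (X - 2 ^ v))) :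
    IsValue a m k X (if best < k + 2 then best else 0) := by
  have key : ∀ c, Cost a m X c → c ≤ k → best ≤ c + 1 := by
    intro c hc hck
    cases hc with
    | zero => exact absurd rfl hX
    | @step _ v c hv hc =>
      rcases hF v hv with ⟨-, h0⟩ | ⟨c', -, hx, -, hmin⟩
      · have := h0 c hc; omega
      · have h1 := h.le_of_testBit v (Nat.zero_le _) hv (by omega)
        have h2 := hmin c hc
        omega
  split_ifs with hb
  · obtain ⟨hv, hpos, heq⟩ := h.attained hb
    rcases hF bv hv with ⟨h0, -⟩ | ⟨c', hc', hx, hcost, -⟩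
    · omega
    · refine .inr ⟨c' + inArcs a m bv X, by omega, by omega, .step hv hcost, fun c hc => ?_⟩
      by_contra hlt
      have := key c hc (by omega)
      omega
  · refine .inl ⟨rfl, fun c hc => ?_⟩
    by_contra hk
    have := key c hc (by omega)
    omega

end FeedbackArcs

/-! ## The program for one set of vertices

Register allocation: 0 to 6 hold constants, 10 to 20 belong to the main loop, 21 to 29 to the
program `bestProg` and the registers from 30 on to the innermost loops. -/

namespace FeedbackArcs
open RAM

/-- The first address of the table of values. -/
def tableStart (n : ℕ) : ℕ := n * n + n + 1

/-- The first address of the list of sets. -/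
def listStart (n : ℕ) : ℕ := n * n + n + 1 + 2 ^ n

/-- A bound for all numbers that occur after the initialization. -/
def bound (n : ℕ) : ℕ := 4 * (n * n + n + 2 ^ n + 1)

/-- The constant registers and the constant part of the memory. -/
structure Layout (n k : ℕ) (s : State) : Prop where
  reg0 : s.reg 0 = n
  reg1 : s.reg 1 = k
  reg2 : s.reg 2 = n * n
  reg3 : s.reg 3 = listStart n
  reg4 : s.reg 4 = tableStart n
  reg5 : s.reg 5 = 1
  reg6 : s.reg 6 = 0
  k_le : k ≤ n * n
  entry_le : ∀ x < n * n, s.mem x ≤ 1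
  pow : ∀ v ≤ n, s.mem (n * n + v) = 2 ^ v

theorem Layout.congr {n k : ℕ} {s s' : State} (h : Layout n k s)
    (hr : ∀ r < 7, s'.reg r = s.reg r) (hm : ∀ x < tableStart n, s'.mem x = s.mem x) :
    Layout n k s' where
  reg0 := (hr 0 (by norm_num)).trans h.reg0
  reg1 := (hr 1 (by norm_num)).trans h.reg1
  reg2 := (hr 2 (by norm_num)).trans h.reg2
  reg3 := (hr 3 (by norm_num)).trans h.reg3
  reg4 := (hr 4 (by norm_num)).trans h.reg4
  reg5 := (hr 5 (by norm_num)).trans h.reg5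
  reg6 := (hr 6 (by norm_num)).trans h.reg6
  k_le := h.k_le
  entry_le x hx := by
    rw [hm x (by unfold tableStart; omega)]; exact h.entry_le x hx
  pow v hv := by
    rw [hm _ (by unfold tableStart; omega)]; exact h.pow v hv

/-- The matrix in the first memory cells. -/
def matrix (n : ℕ) (s : State) (y v : ℕ) : ℕ := if y * n + v < n * n then s.mem (y * n + v) else 0

theorem matrix_congr {n : ℕ} {s s' : State} (h : ∀ x < n * n, s'.mem x = s.mem x) :
    matrix n s' = matrix n s := by
  funext y v
  unfold matrix
  split_ifs with hlt
  · exact h _ hlt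
  · rfl

theorem Layout.matrix_le {n k : ℕ} {s : State} (h : Layout n k s) (y v : ℕ) :
    matrix n s y v ≤ 1 := by
  unfold matrix
  split_ifs with hlt
  · exact h.entry_le _ hlt
  · exact Nat.zero_le _

theorem index_lt {n y v : ℕ} (hy : y < n) (hv : v < n) : y * n + v < n * n := by
  have : (y + 1) * n ≤ n * n := Nat.mul_le_mul_right n hy
  rw [add_mul] at this; omega

theorem inArcs_le {n m v X : ℕ} {a : ℕ → ℕ → ℕ} (ha : ∀ y < m, a y v ≤ 1) (hm : m ≤ n) :
    inArcs a m v X ≤ n := by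
  refine (Finset.sum_le_card_nsmul _ _ 1 fun y hy => ?_).trans (by simpa using hm)
  have := ha y (Finset.mem_range.mp hy)
  split_ifs <;> omega

/-- Computes the number of arcs into the vertex in register 21 from outside the set in
register 20. -/
def inArcsProg : Prog :=
  .seq (ops [.const 30 0, .copy 32 20, .copy 31 10, .add 34 11 21])
    (.loop 6 31
      (.seq (ops [.sub 31 31 5, .sub 34 34 0, .add 35 2 31, .load 33 35])
        (.ite 32 33
          (ops [.load 36 34, .add 30 30 36])
          (ops [.sub 32 32 33]))))

/-- The tails are scanned downwards from `m - 1`. Register 32 holds the part of `X` not yet scanned,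
and register 34 the address of the current matrix entry, which moves up the column by subtracting
`n` since multiplication is unavailable. -/
theorem reaches_inArcsProg {n k m v X : ℕ} {s : State} (h : Layout n k s) (hm : m ≤ n)
    (hv : v < n) (hX : X < 2 ^ m) (h10 : s.reg 10 = m) (h11 : s.reg 11 = m * n)
    (h20 : s.reg 20 = X) (h21 : s.reg 21 = v) :
    Reaches (bound n) inArcsProg s (10 * n + 6) (fun s' => s'.mem = s.mem ∧
      (∀ r < 30, s'.reg r = s.reg r) ∧ s'.reg 30 = inArcs (matrix n s) m v X) := by
  have hmn : m * n ≤ n * n := Nat.mul_le_mul_right n hm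
  have h2n := Nat.two_pow_pos n
  set f : ℕ → ℕ := fun y => if X.testBit y then 0 else matrix n s y v with hf
  let I : ℕ → State → Prop := fun i s' => s'.mem = s.mem ∧ (∀ r < 30, s'.reg r = s.reg r) ∧
    i ≤ m ∧ s'.reg 31 = i ∧ s'.reg 32 = X % 2 ^ i ∧ s'.reg 34 = i * n + v ∧
    s'.reg 30 = ∑ y ∈ Finset.Ico i m, f y
  -- This keeps the partial count in register 30 within `bound n`.
  have hfle : ∀ i, ∑ y ∈ Finset.Ico i m, f y ≤ m - i := by
    intro i
    refine (Finset.sum_le_card_nsmul _ _ 1 fun y hy => ?_).trans (by simp)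
    have hy' := (Finset.mem_Ico.mp hy).2
    have hlt := index_lt (hy'.trans_le hm) hv
    have := h.entry_le _ hlt
    simp only [hf, matrix, if_pos hlt]; split_ifs <;> omega
  have hloop := Reaches.loop (B := bound n) (a := 6) (b := 31)
    (p := .seq (ops [.sub 31 31 5, .sub 34 34 0, .add 35 2 31, .load 33 35])
        (.ite 32 33 (ops [.load 36 34, .add 30 30 36]) (ops [.sub 32 32 33])))
    (Q := fun s' => s'.mem = s.mem ∧ (∀ r < 30, s'.reg r = s.reg r) ∧
      s'.reg 30 = inArcs (matrix n s) m v X) I 9 ?_ ?_ m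
  · refine (Reaches.seq (Reaches.ops (Q := I m) ?_ ?_) hloop).mono ?_ fun _ h => h
    · simp [FitsAll, Instr.Fits, Instr.exec, h11, h21, bound]; omega
    · refine ⟨rfl, fun r hr => ?_, le_rfl, ?_, ?_, ?_, ?_⟩
      · simp (disch := omega) [execs, Instr.exec, Function.update_of_ne]
      all_goals simp [execs, Instr.exec, h10, h11, h20, h21]
      exact (Nat.mod_eq_of_lt hX).symm
    · simp; omega
  · rintro i s' ⟨hmem, hr, him, h31, h32, h34, h30⟩ hlt
    have L' := h.congr (fun r hr' => hr r (by omega)) fun x _ => congrFun hmem x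
    rw [h31, L'.reg6] at hlt
    obtain ⟨j, rfl⟩ : ∃ j, i = j + 1 := ⟨i - 1, by omega⟩
    refine ⟨j, rfl, ?_⟩
    have hpow := h.pow j (by omega)
    have e1 : (j + 1) * n + v - n = j * n + v := by rw [add_mul]; omega
    refine (Reaches.seq (Reaches.ops (Q := fun t => t.mem = s.mem ∧
      (∀ r < 30, t.reg r = s.reg r) ∧ t.reg 31 = j ∧ t.reg 32 = X % 2 ^ (j + 1) ∧
      t.reg 33 = 2 ^ j ∧ t.reg 34 = j * n + v ∧
      t.reg 30 = ∑ y ∈ Finset.Ico (j + 1) m, f y) ?_ ?_) (u := 4) ?_).mono ?_ fun _ h => h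
    · simp [FitsAll, Instr.Fits, Instr.exec, L'.reg2, L'.reg5, h31, bound]; omega
    · refine ⟨hmem, fun r hr' => ?_, ?_, ?_, ?_, ?_, ?_⟩
      · simp (disch := omega) [execs, Instr.exec, Function.update_of_ne, hr r hr']
      all_goals simp [execs, Instr.exec, L'.reg2, L'.reg5, L'.reg0, h31, h32, h34, h30, hmem, hpow, e1]
    · rintro t ⟨tm, tr, t31, t32, t33, t34, t30⟩
      have hsum : ∑ y ∈ Finset.Ico j m, f y = f j + ∑ y ∈ Finset.Ico (j + 1) m, f y :=
        Finset.sum_eq_sum_Ico_succ_bot (by omega) f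
      refine Reaches.ite (fun hlt => ?_) (fun hle => ?_)
      · have hbit : X.testBit j = false := by
          by_contra hc
          have := Nat.testBit_iff_two_pow_le_mod.mp (Bool.eq_true_of_not_eq_false hc)
          omega
        have hfj : s.mem (j * n + v) = f j := by simp [hf, hbit, matrix, index_lt (show j < n by omega) hv]
        refine Reaches.ops ?_ ⟨tm, fun r hr' => ?_, by omega, ?_, ?_, ?_, ?_⟩
        · have := hfle j
          simp [FitsAll, Instr.Fits, Instr.exec, t34, t30, tm, bound, hfj]; omega
        · simp (disch := omega) [execs, Instr.exec, Function.update_of_ne, tr r hr']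
        all_goals simp [execs, Instr.exec, t31, t32, t34, t30, tm, hfj]
        · exact Nat.mod_two_pow_succ_of_not_testBit hbit
        · omega
      · rw [t32, t33] at hle
        have hbit := Nat.testBit_iff_two_pow_le_mod.mpr hle
        refine (Reaches.ops ?_ ⟨tm, fun r hr' => ?_, by omega, ?_, ?_, ?_, ?_⟩).mono
          (t := 2) (by omega) fun _ h => h
        · simp [FitsAll, Instr.Fits]
        · simp (disch := omega) [execs, Instr.exec, Function.update_of_ne, tr r hr']
        all_goals simp [execs, Instr.exec, t31, t32, t33, t34, t30]
        · rw [Nat.mod_two_pow_succ_of_testBit hbit]; omega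
        · rw [hsum]; simp [hf, hbit]
    · simp
  · rintro i s' ⟨hmem, hr, him, h31, h32, h34, h30⟩ hle
    have L' := h.congr (fun r hr' => hr r (by omega)) fun x _ => congrFun hmem x
    rw [h31, L'.reg6] at hle
    obtain rfl : i = 0 := by omega
    refine ⟨hmem, hr, ?_⟩
    rw [h30, inArcs, Finset.range_eq_Ico]

/-- The table of values. -/
def table (n : ℕ) (s : State) (Z : ℕ) : ℕ := s.mem (tableStart n + Z)

/-! ### Minimizing over the last vertex of a set. -/

theorem IsBest.init {a : ℕ → ℕ → ℕ} {F : ℕ → ℕ} {m k X bv : ℕ} (hX : X < 2 ^ m) :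
    IsBest a F m k X m (k + 2) bv where
  le := le_rfl
  le_of_testBit v hv hb := by
    have := Nat.lt_of_testBit_of_lt hb hX
    omega
  attained h := absurd h (lt_irrefl _)

theorem IsBest.pred {a : ℕ → ℕ → ℕ} {F : ℕ → ℕ} {m k X u best bv : ℕ}
    (h : IsBest a F m k X (u + 1) best bv)
    (hu : X.testBit u = true → 0 < F (X - 2 ^ u) → best ≤ F (X - 2 ^ u) + inArcs a m u X) :
    IsBest a F m k X u best bv where
  le := h.le
  le_of_testBit v hv hb hF := by
    rcases Nat.eq_or_lt_of_le hv with rfl | hv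
    · exact hu hb hF
    · exact h.le_of_testBit v hv hb hF
  attained := h.attained

theorem IsBest.pred_of_lt {a : ℕ → ℕ → ℕ} {F : ℕ → ℕ} {m k X u best bv : ℕ}
    (h : IsBest a F m k X (u + 1) best bv) (hb : X.testBit u = true) (hF : 0 < F (X - 2 ^ u))
    (hlt : F (X - 2 ^ u) + inArcs a m u X < best) :
    IsBest a F m k X u (F (X - 2 ^ u) + inArcs a m u X) u where
  le := hlt.le.trans h.le
  le_of_testBit v hv hb hF := by
    rcases Nat.eq_or_lt_of_le hv with rfl | hv
    · exact le_rfl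
    · exact hlt.le.trans (h.le_of_testBit v hv hb hF)
  attained _ := ⟨hb, hF, rfl⟩

/-- One round of `bestProg`. -/
def bestBody : Prog :=
  .seq (ops [.sub 21 21 5, .add 26 2 21, .load 23 26])
    (.ite 22 23 .skip
      (.seq (ops [.sub 22 22 23])
        (.seq inArcsProg
          (.seq (ops [.sub 26 20 23, .add 26 4 26, .load 27 26])
            (.ite 6 27
              (.seq (ops [.add 27 27 30])
                (.ite 27 24 (ops [.copy 24 27, .copy 25 21]) .skip))
              .skip)))))

/-- Computes the value of the set in register 20 into register 24 and the last vertex of an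
optimal ordering into register 25. -/
def bestProg : Prog :=
  .seq (ops [.add 24 1 5, .add 24 24 5, .const 25 0, .copy 21 10, .copy 22 20])
    (.loop 6 21 bestBody)

/-- A bound for the number of steps of `bestProg`. -/
def bestTime (n : ℕ) : ℕ := n * (10 * n + 25) + 7

/-- The vertices are scanned downwards and `IsBest` is maintained for those already seen. The
hypothesis on the table only serves to bound the sums that are formed; that the entries are correct
values enters later, through `IsBest.isValue`. -/
theorem reaches_bestProg {n k m X : ℕ} {s : State} (h : Layout n k s) (hm : m ≤ n)
    (hX : X < 2 ^ m) (h10 : s.reg 10 = m) (h11 : s.reg 11 = m * n) (h20 : s.reg 20 = X)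
    (hF : ∀ v, X.testBit v = true → table n s (X - 2 ^ v) ≤ k + 1) :
    Reaches (bound n) bestProg s (bestTime n) (fun s' => s'.mem = s.mem ∧
      (∀ r < 21, s'.reg r = s.reg r) ∧
      IsBest (matrix n s) (table n s) m k X 0 (s'.reg 24) (s'.reg 25)) := by
  have hk := h.k_le
  have h2n := Nat.two_pow_pos n
  have h2m : 2 ^ m ≤ 2 ^ n := Nat.pow_le_pow_right (by norm_num) hm
  let I : ℕ → State → Prop := fun i s' => s'.mem = s.mem ∧ (∀ r < 21, s'.reg r = s.reg r) ∧
    i ≤ m ∧ s'.reg 21 = i ∧ s'.reg 22 = X % 2 ^ i ∧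
    IsBest (matrix n s) (table n s) m k X i (s'.reg 24) (s'.reg 25)
  have hloop := Reaches.loop (B := bound n) (a := 6) (b := 21) (p := bestBody)
    (Q := fun s' => s'.mem = s.mem ∧ (∀ r < 21, s'.reg r = s.reg r) ∧
      IsBest (matrix n s) (table n s) m k X 0 (s'.reg 24) (s'.reg 25)) I (10 * n + 24) ?_ ?_ m
  · refine (Reaches.seq (Reaches.ops (Q := I m) ?_ ?_) hloop).mono ?_ fun _ h => h
    · simp [FitsAll, Instr.Fits, Instr.exec, h.reg1, h.reg5, bound]; omega
    · refine ⟨rfl, fun r hr => ?_, le_rfl, ?_, ?_, ?_⟩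
      · simp (disch := omega) [execs, Instr.exec, Function.update_of_ne]
      · simp [execs, Instr.exec, h10]
      · simp [execs, Instr.exec, h20, Nat.mod_eq_of_lt hX]
      · have : (execs [.add 24 1 5, .add 24 24 5, .const 25 0, .copy 21 10, .copy 22 20] s).reg 24
            = k + 2 := by simp [execs, Instr.exec, h.reg1, h.reg5]
        rw [this]
        exact .init hX
    · have : m * (10 * n + 24 + 1) ≤ n * (10 * n + 25) := Nat.mul_le_mul_right _ hm
      simp only [bestTime, List.length]; omega
  · rintro i s' ⟨hmem, hr, him, h21, h22, hI⟩ hlt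
    have L' := h.congr (fun r hr' => hr r (by omega)) fun x _ => congrFun hmem x
    rw [h21, L'.reg6] at hlt
    obtain ⟨j, rfl⟩ : ∃ j, i = j + 1 := ⟨i - 1, by omega⟩
    refine ⟨j, rfl, ?_⟩
    have hpow := h.pow j (by omega)
    refine (Reaches.seq (Reaches.ops (Q := fun t => t.mem = s.mem ∧
      (∀ r < 21, t.reg r = s.reg r) ∧ t.reg 21 = j ∧ t.reg 22 = X % 2 ^ (j + 1) ∧
      t.reg 23 = 2 ^ j ∧ t.reg 24 = s'.reg 24 ∧ t.reg 25 = s'.reg 25) ?_ ?_)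
      (u := 10 * n + 20) ?_).mono ?_ fun _ h => h
    · simp [FitsAll, Instr.Fits, Instr.exec, L'.reg2, L'.reg5, h21, bound]; omega
    · refine ⟨hmem, fun r hr' => ?_, ?_, ?_, ?_, ?_, ?_⟩
      · simp (disch := omega) [execs, Instr.exec, Function.update_of_ne, hr r hr']
      all_goals simp [execs, Instr.exec, L'.reg2, L'.reg5, h21, h22, hmem, hpow]
    · rintro t ⟨tm, tr, t21, t22, t23, t24, t25⟩
      refine Reaches.ite (t := 10 * n + 19) (fun hlt => ?_) (fun hle => ?_)
      · have hbit : X.testBit j = false := by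
          by_contra hc
          have := Nat.testBit_iff_two_pow_le_mod.mp (Bool.eq_true_of_not_eq_false hc)
          omega
        refine (Reaches.skip ⟨tm, tr, by omega, t21, ?_, ?_⟩).mono (t := 1) (by omega)
          fun _ h => h
        · rw [t22]; exact Nat.mod_two_pow_succ_of_not_testBit hbit
        · rw [t24, t25]
          exact hI.pred (by simp [hbit])
      · rw [t22, t23] at hle
        have hbit := Nat.testBit_iff_two_pow_le_mod.mpr hle
        have hpX := Nat.ge_two_pow_of_testBit hbit
        have hFj := hF j hbit
        have Lt := h.congr (fun r hr' => tr r (by omega)) fun x _ => congrFun tm x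
        refine (Reaches.seq (Reaches.ops (Q := fun t => t.mem = s.mem ∧
          (∀ r < 21, t.reg r = s.reg r) ∧ t.reg 21 = j ∧ t.reg 22 = X % 2 ^ j ∧
          t.reg 23 = 2 ^ j ∧ t.reg 24 = s'.reg 24 ∧ t.reg 25 = s'.reg 25) ?_ ?_)
          (u := 10 * n + 17) ?_).mono ?_ fun _ h => h
        · simp [FitsAll, Instr.Fits]
        · refine ⟨tm, fun r hr' => ?_, ?_, ?_, ?_, ?_, ?_⟩
          · simp (disch := omega) [execs, Instr.exec, Function.update_of_ne, tr r hr']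
          all_goals simp [execs, Instr.exec, t21, t22, t23, t24, t25]
          rw [Nat.mod_two_pow_succ_of_testBit hbit]; omega
        · clear tm tr t21 t22 t23 t24 t25 Lt
          rintro t ⟨tm, tr, t21, t22, t23, t24, t25⟩
          have Lt := h.congr (fun r hr' => tr r (by omega)) fun x _ => congrFun tm x
          refine (Reaches.seq (reaches_inArcsProg (v := j) (X := X) Lt hm (by omega) hX
            ((tr 10 (by norm_num)).trans h10) ((tr 11 (by norm_num)).trans h11)
            ((tr 20 (by norm_num)).trans h20) t21) (u := 11) ?_).mono (by omega) fun _ h => h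
          rintro q ⟨qm, qr, q30⟩
          have hmat : matrix n t = matrix n s := matrix_congr fun x _ => congrFun tm x
          rw [hmat] at q30
          have hin : inArcs (matrix n s) m j X ≤ n :=
            inArcs_le (fun y _ => h.matrix_le y j) hm
          rw [tm] at qm
          have q20 : q.reg 20 = X := by rw [qr 20 (by norm_num), tr 20 (by norm_num), h20]
          have q21 : q.reg 21 = j := by rw [qr 21 (by norm_num), t21]
          have q22 : q.reg 22 = X % 2 ^ j := by rw [qr 22 (by norm_num), t22]
          have q23 : q.reg 23 = 2 ^ j := by rw [qr 23 (by norm_num), t23]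
          have q24 : q.reg 24 = s'.reg 24 := by rw [qr 24 (by norm_num), t24]
          have q25 : q.reg 25 = s'.reg 25 := by rw [qr 25 (by norm_num), t25]
          have q4 : q.reg 4 = tableStart n := by
            rw [qr 4 (by norm_num), tr 4 (by norm_num), h.reg4]
          have qr' : ∀ r < 21, q.reg r = s.reg r := fun r hr' =>
            (qr r (by omega)).trans (tr r hr')
          refine (Reaches.seq (Reaches.ops (Q := fun t => t.mem = s.mem ∧
            (∀ r < 21, t.reg r = s.reg r) ∧ t.reg 21 = j ∧ t.reg 22 = X % 2 ^ j ∧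
            t.reg 24 = s'.reg 24 ∧ t.reg 25 = s'.reg 25 ∧
            t.reg 27 = table n s (X - 2 ^ j) ∧ t.reg 30 = inArcs (matrix n s) m j X) ?_ ?_)
            (u := 7) ?_).mono ?_ fun _ h => h
          · simp [FitsAll, Instr.Fits, Instr.exec, q4, q20, q23, bound, tableStart]; omega
          · refine ⟨qm, fun r hr' => ?_, ?_, ?_, ?_, ?_, ?_, ?_⟩
            · simp (disch := omega) [execs, Instr.exec, Function.update_of_ne, qr' r hr']
            all_goals simp [execs, Instr.exec, q4, q20, q21, q22, q23, q24, q25, q30, qm, table]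
          · clear tm tr t21 t22 t23 t24 t25 Lt
            rintro t' ⟨tm, tr, t21, t22, t24, t25, t27, t30⟩
            have Lt := h.congr (fun r hr' => tr r (by omega)) fun x _ => congrFun tm x
            refine Reaches.ite (t := 6) (fun hlt => ?_) (fun hle => ?_)
            · rw [Lt.reg6, t27] at hlt
              refine (Reaches.seq (Reaches.ops (Q := fun t => t.mem = s.mem ∧
                (∀ r < 21, t.reg r = s.reg r) ∧ t.reg 21 = j ∧ t.reg 22 = X % 2 ^ j ∧
                t.reg 24 = s'.reg 24 ∧ t.reg 25 = s'.reg 25 ∧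
                t.reg 27 = table n s (X - 2 ^ j) + inArcs (matrix n s) m j X) ?_ ?_)
                (u := 4) ?_).mono ?_ fun _ h => h
              · simp [FitsAll, Instr.Fits, t27, t30, bound]; omega
              · refine ⟨tm, fun r hr' => ?_, ?_, ?_, ?_, ?_, ?_⟩
                · simp (disch := omega) [execs, Instr.exec, Function.update_of_ne, tr r hr']
                all_goals simp [execs, Instr.exec, t21, t22, t24, t25, t27, t30]
              · clear tm tr t21 t22 t24 t25 t27 t30 Lt
                rintro t ⟨tm, tr, t21, t22, t24, t25, t27⟩
                refine Reaches.ite (t := 3) (fun hlt' => ?_) (fun hle => ?_)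
                · rw [t27, t24] at hlt'
                  refine Reaches.ops (by simp [FitsAll, Instr.Fits])
                    ⟨tm, fun r hr' => ?_, by omega, ?_, ?_, ?_⟩
                  · simp (disch := omega) [execs, Instr.exec, Function.update_of_ne, tr r hr']
                  · simp [execs, Instr.exec, t21]
                  · simp [execs, Instr.exec, t22]
                  · simpa [execs, Instr.exec, t27, t21] using hI.pred_of_lt hbit hlt hlt'
                · rw [t27, t24] at hle
                  refine (Reaches.skip ⟨tm, tr, by omega, t21, t22, ?_⟩).mono (t := 1) (by omega)
                    fun _ h => h
                  rw [t24, t25]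
                  exact hI.pred fun _ _ => hle
              · simp
            · rw [Lt.reg6, t27] at hle
              refine (Reaches.skip ⟨tm, tr, by omega, t21, t22, ?_⟩).mono (t := 1) (by omega)
                fun _ h => h
              rw [t24, t25]
              exact hI.pred fun _ h0 => by omega
          · simp
        · simp; omega
    · simp; omega
  · rintro i s' ⟨hmem, hr, him, h21, h22, hI⟩ hle
    have L' := h.congr (fun r hr' => hr r (by omega)) fun x _ => congrFun hmem x
    rw [h21, L'.reg6] at hle
    obtain rfl : i = 0 := by omega
    exact ⟨hmem, hr, hI⟩

end FeedbackArcs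

/-! ## Lists and tables of cheap sets -/

namespace FeedbackArcs
open RAM

theorem length_le_of_increasing {f : ℕ → ℕ} {N M : ℕ}
    (hf : ∀ i j, i < j → j < N → f i < f j) (hM : ∀ j < N, f j < M) : N ≤ M := by
  have key : ∀ i < N, i ≤ f i := by
    intro i
    induction i with
    | zero => intro _; exact Nat.zero_le _
    | succ i ih =>
      intro hi
      exact (ih (by omega)).trans_lt (hf i (i + 1) (by omega) hi)
  rcases Nat.eq_zero_or_pos N with rfl | hN
  · exact Nat.zero_le _
  · have h1 := key (N - 1) (by omega)
    have h2 := hM (N - 1) (by omega)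
    omega

/-- `L` lists the `N` masks less than `2 ^ m` of cheap sets in increasing order, and `F` is the
table of their values. -/
structure Listed (a : ℕ → ℕ → ℕ) (n k m N : ℕ) (F L : ℕ → ℕ) : Prop where
  increasing : ∀ i j, i < j → j < N → L i < L j
  lt : ∀ j < N, L j < 2 ^ m
  cheap : ∀ j < N, Cheap a m k (L j)
  complete : ∀ Z < 2 ^ m, Cheap a m k Z → ∃ j < N, L j = Z
  value : ∀ Z < 2 ^ m, IsValue a m k Z (F Z)
  zero : ∀ Z, 2 ^ m ≤ Z → Z < 2 ^ n → F Z = 0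

/-- `C` lists, in increasing order and starting with the empty set, `N` masks less than `2 ^ m`;
among them are those of all cheap sets. -/
structure Candidates (a : ℕ → ℕ → ℕ) (k m N : ℕ) (C : ℕ → ℕ) : Prop where
  increasing : ∀ i j, i < j → j < N → C i < C j
  lt : ∀ j < N, C j < 2 ^ m
  head : C 0 = 0
  complete : ∀ Z < 2 ^ m, Cheap a m k Z → ∃ j < N, C j = Z

/-- The situation after the first `l` of the candidates `C` have been processed: `w` of them were
cheap and are now listed by `L`. -/
structure Filtered (a : ℕ → ℕ → ℕ) (n k m N : ℕ) (C : ℕ → ℕ) (l w : ℕ) (F L : ℕ → ℕ) :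
    Prop where
  pos : 1 ≤ w
  w_le : w ≤ l
  l_le : l ≤ N
  rest : ∀ t, l ≤ t → t < N → L t = C t
  increasing : ∀ i j, i < j → j < w → L i < L j
  kept : ∀ j < w, Cheap a m k (L j) ∧ ∃ i < l, L j = C i
  complete : ∀ i < l, Cheap a m k (C i) → ∃ j < w, L j = C i
  value : ∀ Z < 2 ^ m, (∃ t, l ≤ t ∧ t < N ∧ Z = C t) ∨ IsValue a m k Z (F Z)
  zero : ∀ Z, 2 ^ m ≤ Z → Z < 2 ^ n → F Z = 0

variable {a : ℕ → ℕ → ℕ} {n k m N l w x : ℕ} {F L F' L' C : ℕ → ℕ}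

theorem Listed.head (h : Listed a n k m N F L) : 0 < N ∧ L 0 = 0 := by
  obtain ⟨j, hj, hL⟩ := h.complete 0 (by positivity) cheap_zero
  refine ⟨by omega, ?_⟩
  rcases Nat.eq_zero_or_pos j with rfl | h0
  · exact hL
  · have := h.increasing 0 j h0 hj
    omega

theorem Listed.length_le (h : Listed a n k m N F L) : N ≤ 2 ^ m :=
  length_le_of_increasing h.increasing h.lt

theorem listed_zero (hF : F 0 = 1) (hF' : ∀ Z, Z ≠ 0 → F Z = 0) (hL : L 0 = 0) :
    Listed a n k 0 1 F L where
  increasing := by omega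
  lt j hj := by obtain rfl : j = 0 := by omega
                simp [hL]
  cheap j hj := by
    obtain rfl : j = 0 := by omega
    rw [hL]; exact cheap_zero
  complete Z hZ _ := ⟨0, by omega, by simp at hZ; omega⟩
  value Z hZ := by
    obtain rfl : Z = 0 := by simpa using hZ
    rw [hF]; exact isValue_zero
  zero Z hZ _ := hF' Z (by simp at hZ; omega)

/-- Completeness is `Cheap.restrict`: deleting vertex `m` from a cheap set leaves a cheap set of the
previous stage. The new masks all follow the old ones, so the order stays increasing. -/
theorem Listed.candidates (h : Listed a n k m N F L) (hC : ∀ j < N, C j = L j)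
    (hC' : ∀ j < N, C (N + j) = L j + 2 ^ m) : Candidates a k (m + 1) (N + N) C where
  increasing i j hij hj := by
    by_cases hjN : j < N
    · rw [hC i (by omega), hC j hjN]; exact h.increasing i j hij hjN
    · obtain ⟨j, rfl⟩ := Nat.exists_eq_add_of_le (not_lt.mp hjN)
      rw [hC' j (by omega)]
      by_cases hiN : i < N
      · rw [hC i hiN]
        have := h.lt i hiN
        omega
      · obtain ⟨i, rfl⟩ := Nat.exists_eq_add_of_le (not_lt.mp hiN)
        rw [hC' i (by omega)]
        have := h.increasing i j (by omega) (by omega)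
        omega
  lt j hj := by
    rw [pow_succ]
    by_cases hjN : j < N
    · rw [hC j hjN]
      have := h.lt j hjN
      omega
    · obtain ⟨j, rfl⟩ := Nat.exists_eq_add_of_le (not_lt.mp hjN)
      rw [hC' j (by omega)]
      have := h.lt j (by omega)
      omega
  head := by rw [hC 0 h.head.1, h.head.2]
  complete Z hZ hc := by
    obtain ⟨j, hj, hL⟩ := h.complete _ (Nat.mod_lt _ (by positivity)) hc.restrict
    by_cases hlt : Z < 2 ^ m
    · rw [Nat.mod_eq_of_lt hlt] at hL
      exact ⟨j, by omega, by rw [hC j hj, hL]⟩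
    · refine ⟨N + j, by omega, ?_⟩
      rw [pow_succ] at hZ
      rw [hC' j hj, hL, Nat.mod_eq_sub_mod (by omega), Nat.mod_eq_of_lt (by omega)]
      omega

/-- The table still holds values of the previous stage. Stale nonzero entries belong to previously
cheap sets; these are candidates and will be recomputed. Every other entry is `0`, which is right
for a set that is no candidate. The empty set keeps its value `1`, so processing can begin at
position `1`. -/
theorem Candidates.filtered (h : Candidates a k (m + 1) (N + N) C) (hL : Listed a n k m N F L)
    (hC : ∀ j < N, C j = L j) (hL' : ∀ t < N + N, L' t = C t)
    (hmn : 2 ^ (m + 1) ≤ 2 ^ n) :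
    Filtered a n k (m + 1) (N + N) C 1 1 F L' where
  pos := le_rfl
  w_le := le_rfl
  l_le := by have := hL.head.1; omega
  rest t _ ht := hL' t ht
  increasing := by omega
  kept j hj := by
    obtain rfl : j = 0 := by omega
    have := hL.head.1
    rw [hL' 0 (by omega)]
    exact ⟨by rw [h.head]; exact cheap_zero, 0, by omega, rfl⟩
  complete i hi _ := by
    obtain rfl : i = 0 := by omega
    have := hL.head.1
    exact ⟨0, by omega, hL' 0 (by omega)⟩
  value Z hZ := by
    have hpos := hL.head.1
    by_cases hex : ∃ t, 1 ≤ t ∧ t < N + N ∧ Z = C t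
    · exact .inl hex
    · refine .inr ?_
      by_cases h0 : Z = 0
      · subst h0
        rcases hL.value 0 (by positivity) with ⟨-, hv⟩ | ⟨c, -, hv, hc, -⟩
        · exact absurd (hv 0 .zero) (by omega)
        · rw [hv, hc.eq_zero]; exact isValue_zero
      · have hnc : ¬ Cheap a (m + 1) k Z := by
          intro hc
          obtain ⟨j, hj, hCj⟩ := h.complete Z hZ hc
          refine hex ⟨j, ?_, hj, hCj.symm⟩
          by_contra hj0
          obtain rfl : j = 0 := by omega
          exact h0 (by rw [← hCj, h.head])
        have hF0 : F Z = 0 := by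
          by_cases hlt : Z < 2 ^ m
          · by_contra hne
            obtain ⟨j, hj, hLj⟩ := hL.complete Z hlt
              ((hL.value Z hlt).cheap_iff.mpr (Nat.pos_of_ne_zero hne))
            refine hex ⟨j, ?_, by omega, by rw [hC j hj, hLj]⟩
            by_contra hj0
            obtain rfl : j = 0 := by omega
            exact h0 (by rw [← hLj, hL.head.2])
          · exact hL.zero Z (not_lt.mp hlt) (by omega)
        rw [hF0]
        exact .of_not_cheap hnc
  zero Z hZ hn := hL.zero Z (by rw [pow_succ] at hZ; omega) hn

/-- Removing an element decreases the mask, and candidates are processed in increasing order, so the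
smaller set is not among those still pending. -/
theorem Filtered.value_sub (h : Filtered a n k m N C l w F L) (hC : Candidates a k m N C)
    (hl : l < N) {v : ℕ} (hv : (C l).testBit v = true) :
    IsValue a m k (C l - 2 ^ v) (F (C l - 2 ^ v)) := by
  have h1 := hC.lt l hl
  have h2 := Nat.ge_two_pow_of_testBit hv
  have h3 := Nat.two_pow_pos v
  refine (h.value (C l - 2 ^ v) (by omega)).resolve_left ?_
  rintro ⟨t, ht, htN, heq⟩
  rcases Nat.eq_or_lt_of_le ht with rfl | ht
  · omega
  · have := hC.increasing l t ht htN
    omega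

theorem Filtered.value_succ (h : Filtered a n k m N C l w F L)
    (hx : IsValue a m k (C l) x) (hF : ∀ Z < 2 ^ m, F' Z = if Z = C l then x else F Z) :
    ∀ Z < 2 ^ m, (∃ t, l + 1 ≤ t ∧ t < N ∧ Z = C t) ∨ IsValue a m k Z (F' Z) := by
  intro Z hZ
  rw [hF Z hZ]
  split_ifs with heq
  · subst heq; exact .inr hx
  · rcases h.value Z hZ with ⟨t, h1, h2, h3⟩ | hval
    · refine .inl ⟨t, ?_, h2, h3⟩
      rcases Nat.eq_or_lt_of_le h1 with rfl | h1
      · exact absurd h3 heq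
      · exact h1
    · exact .inr hval

/-- The list is compacted in place: because `w ≤ l`, writing to position `w` never destroys a
candidate that is still to be read. -/
theorem Filtered.keep (h : Filtered a n k m N C l w F L) (hC : Candidates a k m N C)
    (hl : l < N) (hx : IsValue a m k (C l) x) (hpos : 0 < x)
    (hF : ∀ Z < 2 ^ n, F' Z = if Z = C l then x else F Z) (hmn : 2 ^ m ≤ 2 ^ n)
    (hL : ∀ t, L' t = if t = w then C l else L t) :
    Filtered a n k m N C (l + 1) (w + 1) F' L' where
  pos := by omega
  w_le := by have := h.w_le; omega
  l_le := hl
  rest t ht htN := by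
    have := h.w_le
    rw [hL, if_neg (by omega)]; exact h.rest t (by omega) htN
  increasing i j hij hj := by
    rw [hL, hL, if_neg (by omega)]
    split_ifs with hjw
    · obtain ⟨-, t, ht, heq⟩ := h.kept i (by omega)
      rw [heq]; exact hC.increasing t l ht hl
    · exact h.increasing i j hij (by omega)
  kept j hj := by
    rw [hL]
    split_ifs with hjw
    · exact ⟨hx.cheap_iff.mpr hpos, l, by omega, rfl⟩
    · obtain ⟨h1, t, ht, heq⟩ := h.kept j (by omega)
      exact ⟨h1, t, by omega, heq⟩
  complete i hi hc := by
    rcases Nat.eq_or_lt_of_le (Nat.le_of_lt_succ hi) with rfl | hi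
    · exact ⟨w, by omega, by rw [hL, if_pos rfl]⟩
    · obtain ⟨j, hj, heq⟩ := h.complete i hi hc
      exact ⟨j, by omega, by rw [hL, if_neg (by omega), heq]⟩
  value := h.value_succ hx fun Z hZ => hF Z (by omega)
  zero Z hZ hn := by
    have := hC.lt l hl
    rw [hF Z hn, if_neg (by omega)]; exact h.zero Z hZ hn

theorem Filtered.drop (h : Filtered a n k m N C l w F L)
    (hl : l < N) (hx : IsValue a m k (C l) 0)
    (hF : ∀ Z < 2 ^ n, F' Z = if Z = C l then 0 else F Z) (hmn : 2 ^ m ≤ 2 ^ n) :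
    Filtered a n k m N C (l + 1) w F' L where
  pos := h.pos
  w_le := by have := h.w_le; omega
  l_le := hl
  rest t ht htN := h.rest t (by omega) htN
  increasing := h.increasing
  kept j hj := by
    obtain ⟨h1, t, ht, heq⟩ := h.kept j (by omega)
    exact ⟨h1, t, by omega, heq⟩
  complete i hi hc := by
    rcases Nat.eq_or_lt_of_le (Nat.le_of_lt_succ hi) with rfl | hi
    · exact absurd (hx.cheap_iff.mp hc) (lt_irrefl _)
    · exact h.complete i hi hc
  value := h.value_succ hx fun Z hZ => hF Z (by omega)
  zero Z hZ hn := by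
    rw [hF Z hn, h.zero Z hZ hn, ite_self]

theorem Filtered.listed (h : Filtered a n k m N C N w F L) (hC : Candidates a k m N C) :
    Listed a n k m w F L where
  increasing := h.increasing
  lt j hj := by
    obtain ⟨-, i, hi, heq⟩ := h.kept j hj
    rw [heq]; exact hC.lt i hi
  cheap j hj := (h.kept j hj).1
  complete Z hZ hc := by
    obtain ⟨i, hi, rfl⟩ := hC.complete Z hZ hc
    exact h.complete i hi hc
  value Z hZ := by
    rcases h.value Z hZ with ⟨t, h1, h2, -⟩ | h
    · omega
    · exact h
  zero := h.zero

end FeedbackArcs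

/-! ## The program for one stage -/

namespace FeedbackArcs
open RAM

/-- The list of sets. -/
def listing (n : ℕ) (s : State) (j : ℕ) : ℕ := s.mem (listStart n + j)

/-- Appends to the list of the sets the sets that contain one more vertex. -/
def appendProg : Prog :=
  .loop 16 13 (ops [.add 18 3 16, .load 19 18, .add 19 19 14, .add 18 18 13, .store 18 19,
    .add 16 16 5])

theorem reaches_appendProg {n k m N : ℕ} {s : State} (h : Layout n k s) (hm : m < n)
    (h13 : s.reg 13 = N) (h14 : s.reg 14 = 2 ^ m) (h16 : s.reg 16 = 0) (hN : N ≤ 2 ^ m)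
    (hL : ∀ j < N, listing n s j < 2 ^ m) :
    Reaches (bound n) appendProg s (N * 8 + 1) (fun s' =>
      (∀ x < listStart n + N, s'.mem x = s.mem x) ∧ (∀ r < 16, s'.reg r = s.reg r) ∧
      ∀ j < N, listing n s' (N + j) = listing n s j + 2 ^ m) := by
  have h2m : 2 ^ m + 2 ^ m ≤ 2 ^ n := by
    rw [← mul_two, ← pow_succ]; exact Nat.pow_le_pow_right (by norm_num) hm
  refine Reaches.loop (fun i s' => (∀ x < listStart n + N, s'.mem x = s.mem x) ∧
    (∀ r < 16, s'.reg r = s.reg r) ∧ i ≤ N ∧ s'.reg 16 = N - i ∧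
    ∀ j < N - i, listing n s' (N + j) = listing n s j + 2 ^ m) 7 ?_ ?_ N s
    ⟨fun _ _ => rfl, fun _ _ => rfl, le_rfl, by simp [h16], by simp⟩
  · rintro i s' ⟨hmem, hr, hi, h16', hl⟩ hlt
    have h13' : s'.reg 13 = N := (hr 13 (by norm_num)).trans h13
    have h14' : s'.reg 14 = 2 ^ m := (hr 14 (by norm_num)).trans h14
    have h3 : s'.reg 3 = listStart n := (hr 3 (by norm_num)).trans h.reg3
    have h5 : s'.reg 5 = 1 := (hr 5 (by norm_num)).trans h.reg5
    rw [h16', h13'] at hlt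
    obtain ⟨j, rfl⟩ : ∃ j, i = j + 1 := ⟨i - 1, by omega⟩
    refine ⟨j, rfl, ?_⟩
    have hmem' : s'.mem (listStart n + (N - (j + 1))) = listing n s (N - (j + 1)) :=
      hmem _ (by omega)
    have hlt' := hL (N - (j + 1)) (by omega)
    refine Reaches.ops ?_ ⟨fun x hx => ?_, fun r hr' => ?_, by omega, ?_, fun t ht => ?_⟩
    · simp [FitsAll, Instr.Fits, Instr.exec, h3, h5, h13', h14', h16', hmem', bound, listStart]
        at hmem' ⊢
      omega
    · simp [execs, Instr.exec, h3, h5, h13', h14', h16', hmem']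
      rw [Function.update_of_ne (by omega), hmem x hx]
    · simp (disch := omega) [execs, Instr.exec, Function.update_of_ne, hr r hr']
    · simp [execs, Instr.exec, h16', h5]; omega
    · have e : listStart n + (N - (j + 1)) + N = listStart n + (N + (N - (j + 1))) := by omega
      simp only [listing, execs, Instr.exec]
      simp [h3, h13', h14', h16', hmem', e]
      by_cases htj : t = N - (j + 1)
      · rw [htj]; simp [listing]
      · rw [Function.update_of_ne (by omega)]
        exact hl t (by omega)
  · rintro i s' ⟨hmem, hr, hi, h16', hl⟩ hle
    have h13' : s'.reg 13 = N := (hr 13 (by norm_num)).trans h13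
    rw [h16', h13'] at hle
    exact ⟨hmem, hr, fun j hj => hl j (by omega)⟩

/-- Processes the next candidate. -/
def filterBody : Prog :=
  .seq (ops [.add 18 3 16, .load 20 18])
    (.seq bestProg
      (.seq (ops [.add 18 4 20, .add 19 1 5, .add 19 19 5])
        (.seq
          (.ite 24 19
            (ops [.store 18 24, .add 18 3 17, .store 18 20, .add 17 17 5])
            (ops [.store 18 6]))
          (ops [.add 16 16 5]))))

/-- Computes the values of all candidates and keeps the cheap ones. -/
def filterProg : Prog := .loop 16 15 filterBody

/-- The invariant is `Filtered`, with register 16 as reading position and register 17 as writing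
position. Both start at `1`, so `N - 1` rounds suffice. -/
theorem reaches_filterProg {n k m N : ℕ} {s : State} {C : ℕ → ℕ} (h : Layout n k s) (hm : m ≤ n)
    (h10 : s.reg 10 = m) (h11 : s.reg 11 = m * n) (h15 : s.reg 15 = N) (h16 : s.reg 16 = 1)
    (h17 : s.reg 17 = 1) (hC : Candidates (matrix n s) k m N C)
    (hf : Filtered (matrix n s) n k m N C 1 1 (table n s) (listing n s)) :
    Reaches (bound n) filterProg s (N * (bestTime n + 16) + 1) (fun s' =>
      (∀ x < tableStart n, s'.mem x = s.mem x) ∧ (∀ r < 16, s'.reg r = s.reg r) ∧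
      Listed (matrix n s) n k m (s'.reg 17) (table n s') (listing n s')) := by
  have h2m : 2 ^ m ≤ 2 ^ n := Nat.pow_le_pow_right (by norm_num) hm
  have hk := h.k_le
  have hN : N ≤ 2 ^ m := length_le_of_increasing hC.increasing hC.lt
  refine (Reaches.loop (fun i s' => (∀ x < tableStart n, s'.mem x = s.mem x) ∧
    (∀ r < 16, s'.reg r = s.reg r) ∧ ∃ l, s'.reg 16 = l ∧ N = i + l ∧
    Filtered (matrix n s) n k m N C l (s'.reg 17) (table n s') (listing n s'))
    (bestTime n + 15) ?_ ?_ (N - 1) s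
    ⟨fun _ _ => rfl, fun _ _ => rfl, 1, h16, by have := hf.l_le; omega, by rw [h17]; exact hf⟩).mono
    (Nat.add_le_add_right (Nat.mul_le_mul_right (bestTime n + 16) (Nat.sub_le N 1)) 1) fun _ h => h
  · rintro i s' ⟨hmem, hr, l, h16', hl, hF⟩ hlt
    rw [h16', hr 15 (by norm_num), h15] at hlt
    obtain ⟨j, rfl⟩ : ∃ j, i = j + 1 := ⟨i - 1, by omega⟩
    refine ⟨j, rfl, ?_⟩
    have L' := h.congr (fun r hr' => hr r (by omega)) hmem
    have hCl : s'.mem (listStart n + l) = C l := hF.rest l le_rfl hlt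
    have hlt' := hC.lt l hlt
    have hmat : matrix n s' = matrix n s :=
      matrix_congr fun x hx => hmem x (by unfold tableStart; omega)
    have hwl := hF.w_le
    set w := s'.reg 17 with hw
    refine (Reaches.seq (Reaches.ops (Q := fun t => t.mem = s'.mem ∧
      (∀ r < 18, t.reg r = s'.reg r) ∧ t.reg 20 = C l) ?_ ?_)
      (u := bestTime n + 12) ?_).mono (by simp; omega) fun _ h => h
    · simp [FitsAll, Instr.Fits, L'.reg3, h16', bound, listStart]; omega
    · refine ⟨rfl, fun r hr' => ?_, ?_⟩
      · simp (disch := omega) [execs, Instr.exec, Function.update_of_ne]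
      · simp [execs, Instr.exec, L'.reg3, h16', hCl]
    · rintro t ⟨tm, tr, t20⟩
      have Lt := L'.congr (fun r hr' => tr r (by omega)) fun x _ => congrFun tm x
      have htab : table n t = table n s' := by unfold table; rw [tm]
      refine (Reaches.seq (reaches_bestProg Lt hm hlt'
        (by rw [tr 10 (by norm_num), hr 10 (by norm_num), h10])
        (by rw [tr 11 (by norm_num), hr 11 (by norm_num), h11]) t20
        (fun v hv => by rw [htab]; exact (hF.value_sub hC hlt hv).le))
        (u := 12) ?_).mono le_rfl fun _ h => h
      rintro q ⟨qm, qr, hbest⟩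
      rw [tm] at qm
      rw [htab, matrix_congr (fun x _ => congrFun tm x), hmat] at hbest
      have qr' : ∀ r < 18, q.reg r = s'.reg r := fun r hr' =>
        (qr r (by omega)).trans (tr r hr')
      have q20 : q.reg 20 = C l := (qr 20 (by norm_num)).trans t20
      have hl1 := hF.pos
      -- The recursion needs a last vertex; the empty set stands at position `0` only, and `l ≥ 1`.
      have hC0 : C l ≠ 0 := by
        have := hC.increasing 0 l (by omega) hlt
        omega
      have hval := hbest.isValue hC0 fun v hv => hF.value_sub hC hlt hv
      have hble := hbest.le
      set best := q.reg 24 with hbdef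
      refine (Reaches.seq (Reaches.ops (Q := fun t => t.mem = s'.mem ∧
        (∀ r < 18, t.reg r = s'.reg r) ∧ t.reg 18 = tableStart n + C l ∧ t.reg 19 = k + 2 ∧
        t.reg 20 = C l ∧ t.reg 24 = best) ?_ ?_)
        (u := 8) ?_).mono (by simp) fun _ h => h
      · simp [FitsAll, Instr.Fits, Instr.exec, qr', q20, L'.reg4, L'.reg1, L'.reg5, bound,
          tableStart]
        omega
      · refine ⟨qm, fun r hr' => ?_, ?_, ?_, ?_, ?_⟩
        · simp (disch := omega) [execs, Instr.exec, Function.update_of_ne, qr' r hr']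
        all_goals simp [execs, Instr.exec, qr', q20, L'.reg4, L'.reg1, L'.reg5, hbdef]
      · clear tm tr t20 Lt htab
        rintro t ⟨tm, tr, t18, t19, t20, t24⟩
        have t3 : t.reg 3 = listStart n := (tr 3 (by norm_num)).trans L'.reg3
        have t5 : t.reg 5 = 1 := (tr 5 (by norm_num)).trans L'.reg5
        have t6 : t.reg 6 = 0 := (tr 6 (by norm_num)).trans L'.reg6
        have t16 : t.reg 16 = l := (tr 16 (by norm_num)).trans h16'
        have t17 : t.reg 17 = w := tr 17 (by norm_num)
        refine (Reaches.seq (R := fun q => (∀ x < tableStart n, q.mem x = s.mem x) ∧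
          (∀ r < 16, q.reg r = s.reg r) ∧ q.reg 16 = l ∧
          Filtered (matrix n s) n k m N C (l + 1) (q.reg 17) (table n q) (listing n q))
          (Reaches.ite (t := 5) (fun hb => ?_) (fun hb => ?_)) (u := 2) ?_).mono le_rfl
          fun _ h => h
        · rw [t24, t19] at hb
          rw [if_pos hb] at hval
          have hpos : 0 < best := by
            have := (hbest.attained hb).2
            omega
          refine Reaches.ops ?_ ⟨fun x hx => ?_, fun r hr' => ?_, ?_, ?_⟩
          · simp [FitsAll, Instr.Fits, Instr.exec, t3, t5, t17, bound, listStart]; omega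
          · unfold tableStart at hx
            simp [execs, Instr.exec, t3, t17, t18, tm]
            rw [Function.update_of_ne (by unfold listStart; omega),
              Function.update_of_ne (by unfold tableStart; omega)]
            exact hmem x hx
          · simp (disch := omega) [execs, Instr.exec, Function.update_of_ne, tr r, hr r hr']
          · simp [execs, Instr.exec, t16]
          · simp [execs, Instr.exec, t17, t5]
            refine hF.keep hC hlt hval hpos (fun Z hZ => ?_) h2m fun j => ?_
            · simp [table, t3, t18, t20, t24, tm]
              rw [Function.update_of_ne (by unfold listStart tableStart; omega),
                Function.update_apply]
              simp
            · simp [listing, t3, t18, t20, t24, tm, Function.update_apply]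
              rw [if_neg (show listStart n + j ≠ tableStart n + C l by
                unfold listStart tableStart; omega)]
        · rw [t24, t19] at hb
          rw [if_neg (by omega)] at hval
          refine (Reaches.ops ?_ ⟨fun x hx => ?_, fun r hr' => ?_, ?_, ?_⟩).mono (t := 2)
            (by omega) fun _ h => h
          · simp [FitsAll, Instr.Fits]
          · simp [execs, Instr.exec, t18, tm]
            rw [Function.update_of_ne (by omega)]
            exact hmem x hx
          · simp (disch := omega) [execs, Instr.exec, tr r, hr r hr']
          · simp [execs, Instr.exec, t16]
          · have hlist : listing n (execs [.store 18 6] t) = listing n s' := by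
              funext j
              simp only [execs, Instr.exec, listing, t18, tm]
              rw [Function.update_of_ne (by unfold listStart tableStart; omega)]
            rw [hlist]
            simp [execs, Instr.exec, t17]
            refine hF.drop hlt hval (fun Z hZ => ?_) h2m
            simp [table, t18, t6, tm, Function.update_apply]
        · rintro q ⟨q1, q2, q3, q4⟩
          have q5 : q.reg 5 = 1 := (q2 5 (by norm_num)).trans h.reg5
          refine Reaches.ops ?_ ⟨fun x hx => ?_, fun r hr' => ?_, l + 1, ?_, by omega, ?_⟩
          · simp [FitsAll, Instr.Fits, q5, q3, bound]; omega
          · simpa [execs, Instr.exec] using q1 x hx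
          · simp (disch := omega) [execs, Instr.exec, Function.update_of_ne, q2 r hr']
          · simp [execs, Instr.exec, q3, q5]
          · simp [execs, Instr.exec]
            exact q4
  · rintro i s' ⟨hmem, hr, l, h16', hl, hF⟩ hle
    rw [h16', hr 15 (by norm_num), h15] at hle
    have := hF.l_le
    obtain rfl : l = N := by omega
    exact ⟨hmem, hr, hF.listed hC⟩

/-- Adds the next vertex. If the digraph induced by the first vertices has no feedback arc set of
size at most `k`, register 12 becomes `0`. -/
def stageProg : Prog :=
  .seq (ops [.add 18 2 10, .load 14 18, .add 10 10 5, .add 11 11 0, .add 15 13 13, .const 16 0])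
    (.seq appendProg
      (.seq (ops [.const 16 1, .const 17 1])
        (.seq filterProg
          (.seq (ops [.copy 13 17, .add 19 14 14, .sub 19 19 5, .add 19 4 19, .load 19 19])
            (.ite 6 19 .skip (ops [.const 12 0]))))))

/-- A bound for the number of steps of `stageProg` for a list of length `N`. -/
def stageTime (n N : ℕ) : ℕ := N * 8 + (N + N) * (bestTime n + 16) + 21

/-- The time depends on the length `N` of the list before the stage, since at most `2 * N`
candidates are examined. Feasibility is then read from the single table entry at the full mask `2 ^
(m + 1) - 1`. -/
theorem reaches_stageProg {n k m N : ℕ} {s : State} (h : Layout n k s) (hm : m < n)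
    (h10 : s.reg 10 = m) (h11 : s.reg 11 = m * n) (h13 : s.reg 13 = N)
    (hL : Listed (matrix n s) n k m N (table n s) (listing n s)) :
    Reaches (bound n) stageProg s (stageTime n N) (fun s' =>
      (∀ x < tableStart n, s'.mem x = s.mem x) ∧ (∀ r < 10, s'.reg r = s.reg r) ∧
      s'.reg 10 = m + 1 ∧ s'.reg 11 = (m + 1) * n ∧
      Listed (matrix n s) n k (m + 1) (s'.reg 13) (table n s') (listing n s') ∧
      ((Cheap (matrix n s) (m + 1) k (2 ^ (m + 1) - 1) ∧ s'.reg 12 = s.reg 12) ∨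
        (¬ Cheap (matrix n s) (m + 1) k (2 ^ (m + 1) - 1) ∧ s'.reg 12 = 0))) := by
  have hN := hL.length_le
  have h2m : 2 ^ (m + 1) ≤ 2 ^ n := Nat.pow_le_pow_right (by norm_num) hm
  have hps : 2 ^ (m + 1) = 2 ^ m + 2 ^ m := by rw [pow_succ, mul_two]
  have h2pos := Nat.two_pow_pos m
  have hmn : (m + 1) * n ≤ n * n := Nat.mul_le_mul_right n hm
  have hmn' : (m + 1) * n = m * n + n := by rw [add_mul, one_mul]
  refine (Reaches.seq (Reaches.ops (Q := fun t => t.mem = s.mem ∧ (∀ r < 10, t.reg r = s.reg r) ∧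
    t.reg 10 = m + 1 ∧ t.reg 11 = (m + 1) * n ∧ t.reg 12 = s.reg 12 ∧ t.reg 13 = N ∧
    t.reg 14 = 2 ^ m ∧ t.reg 15 = N + N ∧ t.reg 16 = 0) ?_ ?_)
    (u := N * 8 + (N + N) * (bestTime n + 16) + 14) ?_).mono
    (by simp only [stageTime, List.length]; omega) fun _ h => h
  · simp [FitsAll, Instr.Fits, Instr.exec, h.reg0, h.reg2, h.reg5, h10, h11, h13, bound]; omega
  · refine ⟨rfl, fun r hr => ?_, ?_, ?_, ?_, ?_, ?_, ?_, ?_⟩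
    · simp (disch := omega) [execs, Instr.exec, Function.update_of_ne]
    all_goals simp [execs, Instr.exec, h.reg0, h.reg2, h.reg5, h10, h11, h13, h.pow m hm.le, hmn']
  rintro t ⟨tm, tr, t10, t11, t12, t13, t14, t15, t16⟩
  have Lt := h.congr (fun r hr' => tr r (by omega)) fun x _ => congrFun tm x
  have hlt : listing n t = listing n s := by unfold listing; rw [tm]
  refine (Reaches.seq (reaches_appendProg Lt hm t13 t14 t16 hN fun j hj => by
    rw [hlt]; exact hL.lt j hj) (u := (N + N) * (bestTime n + 16) + 13) ?_).mono (by omega)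
    fun _ h => h
  rintro q ⟨qm, qr, qL⟩
  rw [hlt] at qL
  refine (Reaches.seq (Reaches.ops (Q := fun t => t.mem = q.mem ∧ (∀ r < 16, t.reg r = q.reg r) ∧
    t.reg 16 = 1 ∧ t.reg 17 = 1) ?_ ?_)
    (u := (N + N) * (bestTime n + 16) + 10) ?_).mono
    (by simp only [List.length]; omega) fun _ h => h
  · simp [FitsAll, Instr.Fits, bound]; omega
  · refine ⟨rfl, fun r hr => ?_, ?_, ?_⟩
    · simp (disch := omega) [execs, Instr.exec, Function.update_of_ne]
    all_goals simp [execs, Instr.exec]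
  rintro p ⟨pm, pr, p16, p17⟩
  have pm' : ∀ x < listStart n + N, p.mem x = s.mem x := fun x hx => by
    rw [pm, qm x hx, tm]
  have pr' : ∀ r < 16, p.reg r = t.reg r := fun r hr => (pr r hr).trans (qr r hr)
  have hpt : ∀ x < tableStart n, p.mem x = s.mem x := fun x hx =>
    pm' x (by unfold tableStart at hx; unfold listStart; omega)
  have hpm : matrix n p = matrix n s :=
    matrix_congr fun x hx => hpt x (by unfold tableStart; omega)
  have hpT : ∀ Z < 2 ^ n, table n p Z = table n s Z := fun Z hZ =>
    pm' _ (by unfold tableStart listStart; omega)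
  have Lp := h.congr (fun r hr' => (pr' r (by omega)).trans (tr r (by omega))) hpt
  have hL' : Listed (matrix n s) n k m N (table n p) (listing n s) :=
    { hL with
      value := fun Z hZ => by rw [hpT Z (by omega)]; exact hL.value Z hZ
      zero := fun Z hZ hn => by rw [hpT Z hn]; exact hL.zero Z hZ hn }
  have hlp : ∀ j < N, listing n p j = listing n s j := fun j hj => pm' _ (by omega)
  have hlp' : ∀ j < N, listing n p (N + j) = listing n s j + 2 ^ m := fun j hj => by
    rw [← qL j hj]; exact congrFun pm _
  have hC := hL'.candidates hlp hlp'
  have hF := hC.filtered hL' hlp (fun _ _ => rfl) h2m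
  rw [← hpm] at hC hF
  refine (Reaches.seq (reaches_filterProg Lp hm ((pr' 10 (by norm_num)).trans t10)
    ((pr' 11 (by norm_num)).trans t11) ((pr' 15 (by norm_num)).trans t15) p16 p17 hC hF)
    (u := 9) ?_).mono (by omega) fun _ h => h
  rw [hpm]
  rintro f ⟨fm, fr, fL⟩
  have fm' : ∀ x < tableStart n, f.mem x = s.mem x := fun x hx => (fm x hx).trans (hpt x hx)
  have fr' : ∀ r < 16, f.reg r = t.reg r := fun r hr => (fr r hr).trans (pr' r hr)
  have f4 : f.reg 4 = tableStart n := by rw [fr' 4 (by norm_num), Lt.reg4]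
  have f5 : f.reg 5 = 1 := by rw [fr' 5 (by norm_num), Lt.reg5]
  have f6 : f.reg 6 = 0 := by rw [fr' 6 (by norm_num), Lt.reg6]
  have f14 : f.reg 14 = 2 ^ m := by rw [fr' 14 (by norm_num), t14]
  have hfull := (fL.value (2 ^ (m + 1) - 1) (by omega)).cheap_iff
  refine (Reaches.seq (Reaches.ops (Q := fun t => t.mem = f.mem ∧ (∀ r < 13, t.reg r = f.reg r) ∧
    t.reg 13 = f.reg 17 ∧ t.reg 19 = table n f (2 ^ (m + 1) - 1)) ?_ ?_)
    (u := 3) ?_).mono (by simp) fun _ h => h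
  · simp [FitsAll, Instr.Fits, Instr.exec, f4, f5, f14, bound, tableStart]; omega
  · refine ⟨rfl, fun r hr => ?_, ?_, ?_⟩
    · simp (disch := omega) [execs, Instr.exec, Function.update_of_ne]
    all_goals simp [execs, Instr.exec, f4, f5, f14, table, hps]
  rintro e ⟨em, er, e13, e19⟩
  have hT : table n e = table n f := by unfold table; rw [em]
  have hLi : listing n e = listing n f := by unfold listing; rw [em]
  have e6 : e.reg 6 = 0 := by rw [er 6 (by norm_num), f6]
  refine Reaches.ite (fun hlt => ?_) (fun hle => ?_)
  · rw [e6, e19] at hlt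
    refine (Reaches.skip ⟨fun x hx => by rw [em]; exact fm' x hx, fun r hr => ?_, ?_, ?_, ?_,
      .inl ⟨hfull.mpr hlt, ?_⟩⟩).mono (t := 1) (by omega) fun _ h => h
    · rw [er r (by omega), fr' r (by omega), tr r hr]
    · rw [er 10 (by norm_num), fr' 10 (by norm_num), t10]
    · rw [er 11 (by norm_num), fr' 11 (by norm_num), t11]
    · rw [hT, hLi, e13]; exact fL
    · rw [er 12 (by norm_num), fr' 12 (by norm_num), t12]
  · rw [e6, e19] at hle
    refine (Reaches.ops ?_ ⟨fun x hx => ?_, fun r hr => ?_, ?_, ?_, ?_,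
      .inr ⟨fun hc => ?_, ?_⟩⟩).mono (t := 2) (by omega) fun _ h => h
    · simp [FitsAll, Instr.Fits]
    · simp [execs, Instr.exec, em, fm' x hx]
    · simp (disch := omega) [execs, Instr.exec, Function.update_of_ne, er r, fr' r, tr r hr]
    · simp [execs, Instr.exec, er, fr', t10]
    · simp [execs, Instr.exec, er, fr', t11]
    · simp [execs, Instr.exec, e13]
      exact hT ▸ hLi ▸ fL
    · have := hfull.mp hc
      omega
    · simp [execs, Instr.exec]

/-- A stage is entered only if the full set of the previous one is cheap, so `hM` bounds the list it
starts from; even a failing stage is thus paid for. Failure sets register 12 to `0`, which also ends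
the loop. -/
theorem reaches_stages {n k M : ℕ} {s : State} (h : Layout n k s)
    (h10 : s.reg 10 = 0) (h11 : s.reg 11 = 0) (h12 : s.reg 12 = n) (h13 : s.reg 13 = 1)
    (hL : Listed (matrix n s) n k 0 1 (table n s) (listing n s))
    (hM : ∀ m ≤ n, Cheap (matrix n s) m k (2 ^ m - 1) → ∀ N F L,
      Listed (matrix n s) n k m N F L → N ≤ M) :
    Reaches (bound n) (.loop 10 12 stageProg) s (n * (stageTime n M + 1) + 1) (fun s' =>
      (∀ x < tableStart n, s'.mem x = s.mem x) ∧ (∀ r < 10, s'.reg r = s.reg r) ∧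
      ((s'.reg 12 = n ∧ s'.reg 10 = n ∧ s'.reg 11 = n * n ∧
          Cheap (matrix n s) n k (2 ^ n - 1) ∧
          ∀ Z < 2 ^ n, IsValue (matrix n s) n k Z (table n s' Z)) ∨
        (s'.reg 12 = 0 ∧ 0 < n ∧ ¬ Cheap (matrix n s) n k (2 ^ n - 1)))) := by
  refine Reaches.loop (fun i s' =>
    (∀ x < tableStart n, s'.mem x = s.mem x) ∧ (∀ r < 10, s'.reg r = s.reg r) ∧
      ((∃ m, n = m + i ∧ s'.reg 12 = n ∧ s'.reg 10 = m ∧ s'.reg 11 = m * n ∧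
          Cheap (matrix n s) m k (2 ^ m - 1) ∧
          Listed (matrix n s) n k m (s'.reg 13) (table n s') (listing n s')) ∨
        (s'.reg 12 = 0 ∧ 0 < n ∧ ¬ Cheap (matrix n s) n k (2 ^ n - 1)))) (stageTime n M) ?_ ?_ n s
    ⟨fun _ _ => rfl, fun _ _ => rfl, .inl ⟨0, by simp, h12, h10, by simp [h11], cheap_zero,
      by rw [h13]; exact hL⟩⟩
  · rintro i s' ⟨hmem, hr, ⟨m, hmi, g12, g10, g11, hc, hL'⟩ | ⟨g12, -⟩⟩ hlt
    · rw [g10, g12] at hlt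
      obtain ⟨j, rfl⟩ : ∃ j, i = j + 1 := ⟨i - 1, by omega⟩
      refine ⟨j, rfl, ?_⟩
      have L' := h.congr (fun r hr' => hr r (by omega)) hmem
      have hmat : matrix n s' = matrix n s :=
        matrix_congr fun x hx => hmem x (by unfold tableStart; omega)
      have hN := hM m (by omega) hc _ _ _ hL'
      refine (reaches_stageProg L' hlt g10 g11 rfl (by rw [hmat]; exact hL')).mono ?_ ?_
      · have := Nat.mul_le_mul_right (bestTime n + 16) (Nat.add_le_add hN hN)
        unfold stageTime
        omega
      · rintro t ⟨tm, tr, t10, t11, tL, ht⟩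
        rw [hmat] at tL ht
        refine ⟨fun x hx => (tm x hx).trans (hmem x hx), fun r hr' => (tr r hr').trans (hr r hr'), ?_⟩
        rcases ht with ⟨ht, t12⟩ | ⟨ht, t12⟩
        · exact .inl ⟨m + 1, by omega, t12.trans g12, t10, t11, ht, tL⟩
        · exact .inr ⟨t12, by omega, fun hc => ht (hc.full_of_le (by omega))⟩
    · omega
  · rintro i s' ⟨hmem, hr, ⟨m, hmi, g12, g10, g11, hc, hL'⟩ | hno⟩ hle
    · rw [g10, g12] at hle
      obtain rfl : m = n := by omega
      exact ⟨hmem, hr, .inl ⟨g12, g10, g11, hc, hL'.value⟩⟩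
    · exact ⟨hmem, hr, .inr hno⟩

end FeedbackArcs

/-! ## The program for the output -/

namespace FeedbackArcs
open RAM

theorem index_inj {n y v y' v' : ℕ} (hv : v < n) (hv' : v' < n)
    (h : y * n + v = y' * n + v') : y = y' ∧ v = v' := by
  have hn : 0 < n := by omega
  have h1 : (y * n + v) / n = y := by
    rw [Nat.add_comm, Nat.add_mul_div_right _ _ hn, Nat.div_eq_of_lt hv, Nat.zero_add]
  have h2 : (y' * n + v') / n = y' := by
    rw [Nat.add_comm, Nat.add_mul_div_right _ _ hn, Nat.div_eq_of_lt hv', Nat.zero_add]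
  have hy : y = y' := by rw [← h1, ← h2, h]
  subst hy
  exact ⟨rfl, by omega⟩

/-- Deletes the arcs from the vertices in the set in register 20 to the vertex in register 25. -/
def clearProg : Prog :=
  .seq (ops [.copy 32 20, .copy 31 10, .add 34 11 25])
    (.loop 6 31
      (.seq (ops [.sub 31 31 5, .sub 34 34 0, .add 35 2 31, .load 33 35])
        (.ite 32 33 .skip (ops [.sub 32 32 33, .store 34 6]))))

/-- When `v` is the last vertex of `X`, the entries erased are the forward arcs into `v`. Only cells
of the matrix are written, so the stored powers of two stay readable throughout the scan. -/
theorem reaches_clearProg {n k v X : ℕ} {s : State} (h : Layout n k s)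
    (hv : v < n) (hX : X < 2 ^ n) (h10 : s.reg 10 = n) (h11 : s.reg 11 = n * n)
    (h20 : s.reg 20 = X) (h25 : s.reg 25 = v) :
    Reaches (bound n) clearProg s (10 * n + 5) (fun s' => (∀ r < 30, s'.reg r = s.reg r) ∧
      (∀ y < n, X.testBit y = true → s'.mem (y * n + v) = 0) ∧
      ∀ x, (∀ y < n, X.testBit y = true → x ≠ y * n + v) → s'.mem x = s.mem x) := by
  have h2n := Nat.two_pow_pos n
  have hloop := Reaches.loop (B := bound n) (a := 6) (b := 31)
    (p := .seq (ops [.sub 31 31 5, .sub 34 34 0, .add 35 2 31, .load 33 35])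
        (.ite 32 33 .skip (ops [.sub 32 32 33, .store 34 6])))
    (Q := fun s' => (∀ r < 30, s'.reg r = s.reg r) ∧
      (∀ y < n, X.testBit y = true → s'.mem (y * n + v) = 0) ∧
      ∀ x, (∀ y < n, X.testBit y = true → x ≠ y * n + v) → s'.mem x = s.mem x)
    (fun i s' => (∀ r < 30, s'.reg r = s.reg r) ∧
      (∀ y < n, i ≤ y → X.testBit y = true → s'.mem (y * n + v) = 0) ∧
      (∀ x, (∀ y < n, X.testBit y = true → x ≠ y * n + v) → s'.mem x = s.mem x) ∧
      i ≤ n ∧ s'.reg 31 = i ∧ s'.reg 32 = X % 2 ^ i ∧ s'.reg 34 = i * n + v) 9 ?_ ?_ n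
  · refine (Reaches.seq (Reaches.ops (Q := _) ?_ ?_) hloop).mono ?_ fun _ h => h
    · simp [FitsAll, Instr.Fits, Instr.exec, h11, h25, bound]; omega
    · refine ⟨fun r hr => ?_, fun y hy hny => by omega, fun x _ => rfl, le_rfl, ?_, ?_, ?_⟩
      · simp (disch := omega) [execs, Instr.exec, Function.update_of_ne]
      all_goals simp [execs, Instr.exec, h10, h11, h20, h25]
      exact (Nat.mod_eq_of_lt hX).symm
    · simp; omega
  · rintro i s' ⟨hr, hz, hmem, hin, h31, h32, h34⟩ hlt
    -- The memory changes during the loop, so the layout is asserted for an auxiliary state with the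
    -- old memory, from which only facts about registers are taken.
    have L' := h.congr (s' := ⟨s'.reg, s.mem⟩) (fun r hr' => hr r (by omega)) fun x _ => rfl
    have g5 : s'.reg 5 = 1 := L'.reg5
    have g2 : s'.reg 2 = n * n := L'.reg2
    have g0 : s'.reg 0 = n := L'.reg0
    have g6 : s'.reg 6 = 0 := L'.reg6
    rw [h31, g6] at hlt
    obtain ⟨j, rfl⟩ : ∃ j, i = j + 1 := ⟨i - 1, by omega⟩
    refine ⟨j, rfl, ?_⟩
    have hpow : s'.mem (n * n + j) = 2 ^ j := by
      rw [hmem _ fun y hy _ => ?_, h.pow j (by omega)]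
      have := index_lt hy hv
      omega
    have e1 : (j + 1) * n + v - n = j * n + v := by rw [add_mul]; omega
    refine (Reaches.seq (Reaches.ops (Q := fun t => t.mem = s'.mem ∧
      (∀ r < 30, t.reg r = s.reg r) ∧ t.reg 31 = j ∧ t.reg 32 = X % 2 ^ (j + 1) ∧
      t.reg 33 = 2 ^ j ∧ t.reg 34 = j * n + v) ?_ ?_) (u := 4) ?_).mono ?_ fun _ h => h
    · simp [FitsAll, Instr.Fits, Instr.exec, g2, g5, h31, bound]; omega
    · refine ⟨rfl, fun r hr' => ?_, ?_, ?_, ?_, ?_⟩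
      · simp (disch := omega) [execs, Instr.exec, Function.update_of_ne, hr r hr']
      all_goals simp [execs, Instr.exec, g0, g2, g5, h31, h32, h34, hpow, e1]
    · rintro t ⟨tm, tr, t31, t32, t33, t34⟩
      refine Reaches.ite (fun hlt => ?_) (fun hle => ?_)
      · have hbit : X.testBit j = false := by
          by_contra hc
          have := Nat.testBit_iff_two_pow_le_mod.mp (Bool.eq_true_of_not_eq_false hc)
          omega
        refine (Reaches.skip ⟨tr, fun y hy hjy hb => ?_, fun x hx => ?_, by omega, t31, ?_,
          t34⟩).mono (t := 1) (by omega) fun _ h => h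
        · rw [tm]
          rcases Nat.eq_or_lt_of_le hjy with rfl | hjy
          · simp [hbit] at hb
          · exact hz y hy hjy hb
        · rw [tm]; exact hmem x hx
        · rw [t32]; exact Nat.mod_two_pow_succ_of_not_testBit hbit
      · rw [t32, t33] at hle
        have hbit := Nat.testBit_iff_two_pow_le_mod.mpr hle
        have t6 : t.reg 6 = 0 := (tr 6 (by norm_num)).trans h.reg6
        refine Reaches.ops ?_ ⟨fun r hr' => ?_, fun y hy hjy hb => ?_, fun x hx => ?_,
          by omega, ?_, ?_, ?_⟩
        · simp [FitsAll, Instr.Fits]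
        · simp (disch := omega) [execs, Instr.exec, Function.update_of_ne, tr r hr']
        · have e2 : (execs [.sub 32 32 33, .store 34 6] t).mem
              = Function.update s'.mem (j * n + v) 0 := by
            simp [execs, Instr.exec, t34, t6, tm]
          rw [e2]
          by_cases hyj : y = j
          · subst hyj; simp
          rw [Function.update_of_ne fun hc => hyj (index_inj hv hv hc).1]
          refine hz y hy ?_ hb
          rcases Nat.eq_or_lt_of_le hjy with rfl | hjy
          · omega
          · exact hjy
        · simp [execs, Instr.exec, t34, t6, tm]
          rw [Function.update_of_ne (hx j (by omega) hbit)]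
          exact hmem x hx
        all_goals simp [execs, Instr.exec, t31, t32, t33, t34]
        rw [Nat.mod_two_pow_succ_of_testBit hbit]; omega
    · simp
  · rintro i s' ⟨hr, hz, hmem, hin, h31, h32, h34⟩ hle
    rw [h31, hr 6 (by norm_num), h.reg6] at hle
    exact ⟨hr, fun y hy hb => hz y hy (by omega) hb, hmem⟩

/-! ### Tracing back an optimal ordering. -/

theorem IsValue.unique {a : ℕ → ℕ → ℕ} {m k X x x' : ℕ} (h : IsValue a m k X x)
    (h' : IsValue a m k X x') : x = x' := by
  rcases h with ⟨rfl, h⟩ | ⟨c, hc, rfl, h, hmin⟩ <;>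
    rcases h' with ⟨rfl, h'⟩ | ⟨c', hc', rfl, h', hmin'⟩
  · rfl
  · have := h c' h'; omega
  · have := h' c h; omega
  · have := hmin c' h'; have := hmin' c h; omega

theorem inArcs_congr {a b : ℕ → ℕ → ℕ} {m v X : ℕ} (h : ∀ y < m, a y v = b y v) :
    inArcs a m v X = inArcs b m v X :=
  Finset.sum_congr rfl fun y hy => by rw [h y (Finset.mem_range.mp hy)]

theorem IsBest.congr {a b : ℕ → ℕ → ℕ} {F G : ℕ → ℕ} {m k X u best bv : ℕ}
    (h : IsBest a F m k X u best bv)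
    (hab : ∀ v, X.testBit v = true → ∀ y < m, a y v = b y v)
    (hFG : ∀ v, X.testBit v = true → F (X - 2 ^ v) = G (X - 2 ^ v)) :
    IsBest b G m k X u best bv where
  le := h.le
  le_of_testBit v hu hb hG := by
    rw [← inArcs_congr (hab v hb), ← hFG v hb]
    exact h.le_of_testBit v hu hb (by rwa [hFG v hb])
  attained hlt := by
    obtain ⟨hb, hpos, heq⟩ := h.attained hlt
    rw [← inArcs_congr (hab bv hb), ← hFG bv hb]
    exact ⟨hb, hpos, heq⟩

/-- The arcs into the vertices outside the set with mask `X`, which are ordered by `ρ` after the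
set, have been reduced to those that go backwards; the other arcs have not been changed. -/
structure Reduced (a : ℕ → ℕ → ℕ) (n X : ℕ) (b : ℕ → ℕ → ℕ) (ρ : ℕ → ℕ) : Prop where
  le : ∀ y < n, ∀ v < n, b y v ≤ a y v
  eq : ∀ v, X.testBit v = true → ∀ y < n, b y v = a y v
  lt_rank : ∀ v < n, X.testBit v = false → X < ρ v
  rank : ∀ v < n, X.testBit v = false → ∀ y < n, a y v = 1 →
    b y v = 1 ∨ X.testBit y = true ∨ ρ y < ρ v

/-- The number of arcs into the vertices outside the set with mask `X`. -/
def outsideArcs (b : ℕ → ℕ → ℕ) (n X : ℕ) : ℕ :=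
  ∑ v ∈ Finset.range n, if X.testBit v then 0 else ∑ y ∈ Finset.range n, b y v

/-- The mask `X` itself serves as the rank of `v`: masks shrink as vertices are removed, so `X` lies
below all ranks given before and above the remaining mask. Arcs into `v` from outside `X` stay;
those from `X` are erased and have tails that precede `v`, a loop at `v` being excluded by `ha0`. -/
theorem Reduced.step {a b b' : ℕ → ℕ → ℕ} {n X v : ℕ} {ρ : ℕ → ℕ} (h : Reduced a n X b ρ)
    (hX : X < 2 ^ n) (hv : X.testBit v = true) (ha0 : ∀ v < n, a v v = 0)
    (hb : ∀ y < n, X.testBit y = true → b' y v = 0)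
    (hb' : ∀ y < n, ∀ w < n, (w = v → X.testBit y = false) → b' y w = b y w) :
    Reduced a n (X - 2 ^ v) b' (Function.update ρ v X) where
  le y hy w hw := by
    by_cases hc : w = v → X.testBit y = false
    · rw [hb' y hy w hw hc]; exact h.le y hy w hw
    · push Not at hc
      rw [hc.1, hb y hy (by simpa using hc.2)]
      exact Nat.zero_le _
  eq w hw y hy := by
    rw [Nat.testBit_sub_two_pow hv] at hw
    simp only [ne_eq, decide_not, Bool.and_eq_true, Bool.not_eq_eq_eq_not, Bool.not_true,
      decide_eq_false_iff_not] at hw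
    rw [hb' y hy w (Nat.lt_of_testBit_of_lt hw.1 hX) fun hc => absurd hc hw.2]
    exact h.eq w hw.1 y hy
  lt_rank w hw hwX := by
    have hle := Nat.ge_two_pow_of_testBit hv
    have hpos := Nat.two_pow_pos v
    rw [Function.update_apply]
    split_ifs with hwv
    · omega
    · rw [Nat.testBit_sub_two_pow hv] at hwX
      have := h.lt_rank w hw (by simpa [hwv] using hwX)
      omega
  rank w hw hwX y hy ha := by
    rw [Nat.testBit_sub_two_pow hv] at hwX ⊢
    by_cases hwv : w = v
    · subst hwv
      have hyw : y ≠ w := by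
        rintro rfl
        rw [ha0 y hy] at ha
        exact absurd ha (by norm_num)
      cases hy' : X.testBit y
      · left
        rw [hb' y hy w hw fun _ => hy', h.eq w hv y hy, ha]
      · right; left; simp [hyw]
    · have hw' : X.testBit w = false := by simpa [hwv] using hwX
      rw [hb' y hy w hw fun hc => absurd hc hwv, Function.update_of_ne hwv]
      by_cases hyv : y = v
      · subst hyv
        rw [Function.update_self]
        exact .inr (.inr (h.lt_rank w hw hw'))
      · rw [Function.update_of_ne hyv]
        simpa [hyv] using h.rank w hw hw' y hy ha

/-- Only column `v` joins the count, and what survives in it are the original arcs from outside `X`.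
-/
theorem outsideArcs_step {a b b' : ℕ → ℕ → ℕ} {n X v : ℕ} {ρ : ℕ → ℕ} (h : Reduced a n X b ρ)
    (hX : X < 2 ^ n) (hv : X.testBit v = true)
    (hb : ∀ y < n, X.testBit y = true → b' y v = 0)
    (hb' : ∀ y < n, ∀ w < n, (w = v → X.testBit y = false) → b' y w = b y w) :
    outsideArcs b' n (X - 2 ^ v) = outsideArcs b n X + inArcs a n v X := by
  have hvn := Nat.lt_of_testBit_of_lt hv hX
  unfold outsideArcs
  rw [← Finset.sum_erase_add (Finset.range n)
      (fun w => if (X - 2 ^ v).testBit w then 0 else ∑ y ∈ Finset.range n, b' y w)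
      (Finset.mem_range.mpr hvn),
    ← Finset.sum_erase_add (Finset.range n)
      (fun w => if X.testBit w then 0 else ∑ y ∈ Finset.range n, b y w)
      (Finset.mem_range.mpr hvn), if_pos hv, add_zero]
  congr 1
  · refine Finset.sum_congr rfl fun w hw => ?_
    rw [Finset.mem_erase, Finset.mem_range] at hw
    rw [Nat.testBit_sub_two_pow hv]
    simp only [hw.1, ne_eq, not_false_eq_true, decide_true, Bool.and_true]
    split_ifs
    · rfl
    · exact Finset.sum_congr rfl fun y hy =>
        hb' y (Finset.mem_range.mp hy) w hw.2 fun hc => absurd hc hw.1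
  · rw [Nat.testBit_sub_two_pow hv]
    simp only [ne_eq, not_true_eq_false, decide_false, Bool.and_false, Bool.false_eq_true,
      if_false]
    refine Finset.sum_congr rfl fun y hy => ?_
    rw [Finset.mem_range] at hy
    split_ifs with hby
    · exact hb y hy hby
    · rw [hb' y hy v hvn fun _ => by simpa using hby, h.eq v hv y hy]

theorem card_filter_testBit_step {n X v : ℕ} (hX : X < 2 ^ n) (hv : X.testBit v = true) :
    ((Finset.range n).filter fun y => X.testBit y = true).card =
      ((Finset.range n).filter fun y => (X - 2 ^ v).testBit y = true).card + 1 := by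
  have hmem : v ∈ (Finset.range n).filter fun y => X.testBit y = true := by
    simp [hv, Nat.lt_of_testBit_of_lt hv hX]
  rw [← Finset.card_erase_add_one hmem]
  congr 2
  ext y
  simp [Nat.testBit_sub_two_pow hv]
  tauto

/-- Replaces the matrix of the digraph by that of a feedback arc set. -/
def outputProg : Prog :=
  .seq (ops [.add 18 2 0, .load 20 18, .sub 20 20 5])
    (.loop 6 20
      (.seq bestProg (.seq clearProg (ops [.add 18 2 25, .load 19 18, .sub 20 20 19]))))

/-- A bound for the number of steps of `outputProg`. -/
def outputTime (n : ℕ) : ℕ := n * (bestTime n + 10 * n + 10) + 5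

/-- The invariant balances the arcs kept so far against the optimal cost of the remaining set:
`outsideArcs` plus the encoded value of `X` never exceeds `k + 1`. At `X = 0` the encoded value is
still positive, which leaves at most `k` arcs. -/
theorem reaches_outputProg {n k : ℕ} {s : State} (h : Layout n k s) (h10 : s.reg 10 = n)
    (h11 : s.reg 11 = n * n) (ha0 : ∀ v < n, matrix n s v v = 0)
    (hcheap : Cheap (matrix n s) n k (2 ^ n - 1))
    (hF : ∀ Z < 2 ^ n, IsValue (matrix n s) n k Z (table n s Z)) :
    Reaches (bound n) outputProg s (outputTime n) (fun s' =>
      ∃ ρ, Reduced (matrix n s) n 0 (matrix n s') ρ ∧ outsideArcs (matrix n s') n 0 ≤ k) := by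
  have h2n := Nat.two_pow_pos n
  let I : ℕ → State → Prop := fun i s' => ∃ X ρ, X < 2 ^ n ∧ s'.reg 20 = X ∧
    i = ((Finset.range n).filter fun y => X.testBit y = true).card ∧
    (∀ r < 20, r ≠ 18 → r ≠ 19 → s'.reg r = s.reg r) ∧
    (∀ x, n * n ≤ x → s'.mem x = s.mem x) ∧
    Reduced (matrix n s) n X (matrix n s') ρ ∧ 0 < table n s X ∧
    outsideArcs (matrix n s') n X + table n s X ≤ k + 1
  have hloop := Reaches.loop (B := bound n) (a := 6) (b := 20)
    (p := .seq bestProg (.seq clearProg (ops [.add 18 2 25, .load 19 18, .sub 20 20 19])))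
    (Q := fun s' => ∃ ρ, Reduced (matrix n s) n 0 (matrix n s') ρ ∧
      outsideArcs (matrix n s') n 0 ≤ k) I (bestTime n + 10 * n + 9) ?_ ?_ n
  · refine (Reaches.seq (Reaches.ops (Q := I n) ?_ ?_) hloop).mono ?_ fun _ h => h
    · simp [FitsAll, Instr.Fits, h.reg0, h.reg2, bound]; omega
    · have hpos := (hF (2 ^ n - 1) (by omega)).cheap_iff.mp hcheap
      -- No vertex lies outside the full set, so the initial rank function is arbitrary.
      refine ⟨2 ^ n - 1, 0, by omega, ?_, ?_, fun r hr h18 h19 => ?_, fun x _ => rfl, ?_, hpos, ?_⟩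
      · simp [execs, Instr.exec, h.reg0, h.reg2, h.reg5, h.pow n le_rfl]
      · rw [Finset.filter_true_of_mem] <;> simp
      · simp (disch := omega) [execs, Instr.exec, Function.update_of_ne]
      · refine ⟨fun y _ v _ => le_rfl, fun v _ y _ => rfl, fun v hv hb => ?_, fun v hv hb => ?_⟩ <;>
          simp [hv] at hb
      · have : outsideArcs (matrix n s) n (2 ^ n - 1) = 0 :=
          Finset.sum_eq_zero fun v hv => by simp [Finset.mem_range.mp hv]
        have h2 := (hF (2 ^ n - 1) (by omega)).le
        have h3 : matrix n (execs [.add 18 2 0, .load 20 18, .sub 20 20 5] s) = matrix n s := rfl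
        rw [h3, this]
        omega
    · have : outputTime n = n * (bestTime n + 10 * n + 9 + 1) + 5 := rfl
      simp only [this, List.length]; omega
  · rintro i s' ⟨X, ρ, hX, h20, hi, hr, hmem, hR, hpos, hsum⟩ hlt
    have s6 : s'.reg 6 = 0 := (hr 6 (by norm_num) (by norm_num) (by norm_num)).trans h.reg6
    rw [h20, s6] at hlt
    have htab : table n s' = table n s := by
      funext Z
      exact hmem _ (by unfold tableStart; omega)
    have L' : Layout n k s' :=
      { reg0 := (hr 0 (by norm_num) (by norm_num) (by norm_num)).trans h.reg0
        reg1 := (hr 1 (by norm_num) (by norm_num) (by norm_num)).trans h.reg1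
        reg2 := (hr 2 (by norm_num) (by norm_num) (by norm_num)).trans h.reg2
        reg3 := (hr 3 (by norm_num) (by norm_num) (by norm_num)).trans h.reg3
        reg4 := (hr 4 (by norm_num) (by norm_num) (by norm_num)).trans h.reg4
        reg5 := (hr 5 (by norm_num) (by norm_num) (by norm_num)).trans h.reg5
        reg6 := s6
        k_le := h.k_le
        entry_le := fun x hx => by
          rcases Nat.eq_zero_or_pos n with rfl | hn
          · omega
          have hy : x / n < n := Nat.div_lt_of_lt_mul hx
          have hv : x % n < n := Nat.mod_lt _ hn
          have hxe : x / n * n + x % n = x := by rw [Nat.mul_comm]; exact Nat.div_add_mod x n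
          have h1 := (hR.le _ hy _ hv).trans (h.matrix_le _ _)
          unfold matrix at h1
          rw [hxe, if_pos hx] at h1
          exact h1
        pow := fun v hv => by rw [hmem _ (by omega)]; exact h.pow v hv }
    have hsub : ∀ v, X.testBit v = true → X - 2 ^ v < 2 ^ n := fun v _ => (Nat.sub_le X _).trans_lt hX
    refine ⟨i - 1, ?_, (Reaches.seq (reaches_bestProg L' le_rfl hX
      ((hr 10 (by norm_num) (by norm_num) (by norm_num)).trans h10)
      ((hr 11 (by norm_num) (by norm_num) (by norm_num)).trans h11) h20
      (fun v hv => by rw [htab]; exact (hF _ (hsub v hv)).le)) (u := 10 * n + 9) ?_).mono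
      (by omega) fun _ h => h⟩
    · obtain ⟨v, hv⟩ := Nat.exists_testBit_of_ne_zero (x := X) (by omega)
      rw [hi, card_filter_testBit_step hX hv]; omega
    · rintro t ⟨tm, tr, hbest⟩
      rw [htab] at hbest
      -- The search reads only columns of vertices in `X`, which are still intact, so its result is
      -- valid for the original matrix.
      have hbest' := hbest.congr (fun v hv y hy => hR.eq v hv y hy) fun _ _ => rfl
      -- By uniqueness of values the recomputed minimum is the positive table entry of `X`; hence it
      -- is attained and `v` really ends an optimal ordering.
      have hval := (hbest'.isValue (by omega) fun v hv => hF _ (hsub v hv)).unique (hF X hX)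
      have hlt' : t.reg 24 < k + 2 := by
        by_contra hc
        rw [if_neg hc] at hval; omega
      rw [if_pos hlt'] at hval
      obtain ⟨hbv, hpos', heq⟩ := hbest'.attained hlt'
      set v := t.reg 25 with hv
      have hvn := Nat.lt_of_testBit_of_lt hbv hX
      have Lt := L'.congr (fun r hr' => tr r (by omega)) fun x _ => congrFun tm x
      refine (Reaches.seq (reaches_clearProg Lt hvn hX
        (by rw [tr 10 (by norm_num), hr 10 (by norm_num) (by norm_num) (by norm_num), h10])
        (by rw [tr 11 (by norm_num), hr 11 (by norm_num) (by norm_num) (by norm_num), h11])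
        (by rw [tr 20 (by norm_num), h20]) rfl) (u := 4) ?_).mono (by omega) fun _ h => h
      rintro q ⟨qr, qz, qm⟩
      have q2 : q.reg 2 = n * n := (qr 2 (by norm_num)).trans Lt.reg2
      have q20 : q.reg 20 = X := by rw [qr 20 (by norm_num), tr 20 (by norm_num), h20]
      have q25 : q.reg 25 = v := qr 25 (by norm_num)
      have qm' : ∀ x, n * n ≤ x → q.mem x = s.mem x := fun x hx => by
        rw [qm x fun y hy _ => ?_, tm, hmem x hx]
        have := index_lt hy hvn
        omega
      have qpow : q.mem (n * n + v) = 2 ^ v := by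
        rw [qm' _ (by omega)]; exact h.pow v hvn.le
      have hb : ∀ y < n, X.testBit y = true → matrix n q y v = 0 := fun y hy hyb => by
        unfold matrix
        rw [if_pos (index_lt hy hvn)]; exact qz y hy hyb
      have hb' : ∀ y < n, ∀ w < n, (w = v → X.testBit y = false) →
          matrix n q y w = matrix n s' y w := fun y hy w hw hc => by
        unfold matrix
        rw [if_pos (index_lt hy hw), if_pos (index_lt hy hw), qm, tm]
        intro y' hy' hb' he
        obtain ⟨rfl, hwv⟩ := index_inj hw hvn he
        rw [hc hwv] at hb'
        exact absurd hb' (by simp)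
      refine Reaches.ops ?_ ⟨X - 2 ^ v, Function.update ρ v X, hsub v hbv, ?_, ?_,
        fun r hr' h18 h19 => ?_, fun x hx => ?_, hR.step hX hbv ha0 hb hb', hpos', ?_⟩
      · simp [FitsAll, Instr.Fits, q2, q25, bound]; omega
      · simp [execs, Instr.exec, q2, q25, q20, qpow]
      · rw [hi, card_filter_testBit_step hX hbv]; omega
      · simp (disch := omega) [execs, Instr.exec, Function.update_of_ne, qr r, tr r]
        exact hr r hr' h18 h19
      · exact qm' x hx
      · have := outsideArcs_step hR hX hbv hb hb'
        have h3 : matrix n (execs [.add 18 2 25, .load 19 18, .sub 20 20 19] q) = matrix n q := rfl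
        rw [h3, this]
        omega
  · rintro i s' ⟨X, ρ, hX, h20, hi, hr, hmem, hR, hpos, hsum⟩ hle
    rw [h20, hr 6 (by norm_num) (by norm_num) (by norm_num), h.reg6] at hle
    obtain rfl : X = 0 := by omega
    exact ⟨ρ, hR, by omega⟩

end FeedbackArcs

/-! ## The number of sets with few inversions -/

namespace FeedbackArcs

/-- Each term satisfies `x ^ (i + 1) * t ≤ x ^ i - x ^ (i + 1)`, and these differences telescope;
this form of the geometric sum avoids dividing by `1 - x`. -/
theorem sum_pow_mul_le {x t : ℝ} (hx : 0 ≤ x) (ht : x * t ≤ 1 - x) (j : ℕ) :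
    (∑ i ∈ Finset.range j, x ^ (i + 1)) * t ≤ 1 - x ^ j := by
  induction j with
  | zero => simp
  | succ j ih =>
    rw [Finset.sum_range_succ, add_mul]
    have h1 : x ^ (j + 1) * t ≤ x ^ j * (1 - x) := by
      rw [pow_succ, mul_assoc]
      exact mul_le_mul_of_nonneg_left ht (pow_nonneg hx j)
    have h2 : x ^ (j + 1) = x ^ j * x := pow_succ x j
    linarith

/-- Take logarithms, expand in powers and exchange the sums. For fixed `r ≥ 1` the sum over `i` is
at most `(1 / r) / (exp (r t) - 1) ≤ 1 / (t r²)`, and `∑ 1 / r² = π² / 6`. -/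
theorem prod_inv_one_sub_pow_le {t : ℝ} (ht : 0 < t) (j : ℕ) :
    ∏ i ∈ Finset.range j, (1 - Real.exp (-t) ^ (i + 1))⁻¹ ≤ Real.exp (Real.pi ^ 2 / (6 * t)) := by
  set q := Real.exp (-t) with hq
  have hq0 : 0 < q := Real.exp_pos _
  have hq1 : q < 1 := by rw [hq, Real.exp_lt_one_iff]; linarith
  have hpow : ∀ i : ℕ, q ^ (i + 1) < 1 := fun i => pow_lt_one₀ hq0.le hq1 (by omega)
  have hlog : HasSum (fun r : ℕ => ∑ i ∈ Finset.range j, (q ^ (i + 1)) ^ (r + 1) / ((r : ℝ) + 1))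
      (∑ i ∈ Finset.range j, -Real.log (1 - q ^ (i + 1))) :=
    hasSum_sum fun i _ => Real.hasSum_pow_div_log_of_abs_lt_one
      (by rw [abs_of_pos (by positivity)]; exact hpow i)
  have hzeta : HasSum (fun r : ℕ => t⁻¹ * (1 / ((r + 1 : ℕ) : ℝ) ^ 2))
      (t⁻¹ * (Real.pi ^ 2 / 6)) := by
    have := (hasSum_nat_add_iff' 1).mpr hasSum_zeta_two
    simp only [Finset.sum_range_one, Nat.cast_zero] at this
    norm_num at this
    simpa using this.mul_left t⁻¹
  have hle := hasSum_le (fun r => ?_) hlog hzeta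
  · have hprod : ∏ i ∈ Finset.range j, (1 - q ^ (i + 1))⁻¹
        = Real.exp (∑ i ∈ Finset.range j, -Real.log (1 - q ^ (i + 1))) := by
      rw [Real.exp_sum]
      refine Finset.prod_congr rfl fun i _ => ?_
      rw [Real.exp_neg, Real.exp_log (by linarith [hpow i])]
    rw [hprod]
    refine Real.exp_le_exp.mpr (hle.trans_eq ?_)
    field_simp
  · set x := q ^ (r + 1) with hx
    have hx0 : 0 < x := by positivity
    -- This is `1 + y ≤ exp y` for `y = (r + 1) * t`, multiplied by `x = exp (-y)`.
    have hs : x * ((r + 1) * t) ≤ 1 - x := by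
      have h1 : x = Real.exp (-((r + 1) * t)) := by
        rw [hx, hq, ← Real.exp_nat_mul]; push_cast; ring_nf
      have h2 := Real.add_one_le_exp ((r + 1) * t)
      have h3 : x * Real.exp ((r + 1) * t) = 1 := by
        rw [h1, ← Real.exp_add]; simp
      nlinarith [mul_le_mul_of_nonneg_left h2 hx0.le]
    have h1 := sum_pow_mul_le hx0.le hs j
    have h2 : ∑ i ∈ Finset.range j, (q ^ (i + 1)) ^ (r + 1) / ((r : ℝ) + 1)
        = (∑ i ∈ Finset.range j, x ^ (i + 1)) / ((r : ℝ) + 1) := by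
      rw [Finset.sum_div]
      refine Finset.sum_congr rfl fun i _ => ?_
      rw [hx, ← pow_mul, ← pow_mul, mul_comm]
    have h3 : (0 : ℝ) < (r : ℝ) + 1 := by positivity
    have h4 : 0 ≤ x ^ j := by positivity
    rw [h2, div_le_iff₀ h3]
    push_cast
    rw [← mul_le_mul_iff_left₀ (show 0 < ((r : ℝ) + 1) * t by positivity)]
    refine h1.trans ?_
    field_simp
    linarith

/-! ### Counting sets by their inversions along an ordering. -/

/-- The number of pairs of positions in the list such that the second, but not the first, vertex
is in `S`. -/
def inversions : List ℕ → Finset ℕ → ℕ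
  | [], _ => 0
  | v :: l, S => inversions l S + if v ∈ S then 0 else (l.toFinset ∩ S).card

theorem inversions_insert {l : List ℕ} {v : ℕ} (hv : v ∉ l) (S : Finset ℕ) :
    inversions l (insert v S) = inversions l S := by
  induction l with
  | nil => rfl
  | cons w l ih =>
    rw [List.mem_cons, not_or] at hv
    have h1 : l.toFinset ∩ insert v S = l.toFinset ∩ S := by
      rw [Finset.inter_insert_of_notMem (by simpa using hv.2)]
    have h2 : w ≠ v := fun h => hv.1 h.symm
    simp [inversions, ih hv.2, h1, h2]

/-- Pascal's rule for Gaussian binomials: a set of size `j + 1` that avoids the head of the list has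
`j + 1` inversions with it, and a set containing the head has none. Writing `B j` for the bound, the
induction closes because `q ^ (j + 1) * B (j + 1) + B j = B (j + 1)`. The bound does not depend on
the length of the list. -/
theorem sum_powersetCard_pow_inversions_le {q : ℝ} (h0 : 0 ≤ q) (h1 : q < 1) :
    ∀ (l : List ℕ), l.Nodup → ∀ j : ℕ,
      ∑ S ∈ Finset.powersetCard j l.toFinset, q ^ inversions l S ≤
        ∏ i ∈ Finset.range j, (1 - q ^ (i + 1))⁻¹ := by
  have hpos : ∀ i : ℕ, 0 < 1 - q ^ (i + 1) := fun i =>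
    sub_pos.mpr (pow_lt_one₀ h0 h1 (by omega))
  have hB : ∀ j : ℕ, 0 ≤ ∏ i ∈ Finset.range j, (1 - q ^ (i + 1))⁻¹ := fun j =>
    Finset.prod_nonneg fun i _ => (inv_pos.mpr (hpos i)).le
  intro l
  induction l with
  | nil =>
    intro _ j
    cases j with
    | zero => simp [inversions]
    | succ j =>
      rw [Finset.powersetCard_eq_empty.mpr (by simp), Finset.sum_empty]
      exact hB (j + 1)
  | cons v l ih =>
    intro hl j
    rw [List.nodup_cons] at hl
    have hv : v ∉ l.toFinset := by simpa using hl.1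
    cases j with
    | zero => simpa using pow_le_one₀ h0 h1.le
    | succ j =>
      rw [List.toFinset_cons, Finset.powersetCard_succ_insert hv, Finset.sum_union,
        Finset.sum_image]
      · have e1 : ∑ S ∈ Finset.powersetCard (j + 1) l.toFinset, q ^ inversions (v :: l) S
            = q ^ (j + 1) * ∑ S ∈ Finset.powersetCard (j + 1) l.toFinset, q ^ inversions l S := by
          rw [Finset.mul_sum]
          refine Finset.sum_congr rfl fun S hS => ?_
          rw [Finset.mem_powersetCard] at hS
          have : v ∉ S := fun h => hv (hS.1 h)
          rw [inversions, if_neg this, Finset.inter_eq_right.mpr hS.1, hS.2, pow_add, mul_comm]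
        have e2 : ∑ S ∈ Finset.powersetCard j l.toFinset, q ^ inversions (v :: l) (insert v S)
            = ∑ S ∈ Finset.powersetCard j l.toFinset, q ^ inversions l S := by
          refine Finset.sum_congr rfl fun S hS => ?_
          rw [inversions, if_pos (Finset.mem_insert_self _ _), inversions_insert hl.1, add_zero]
        rw [e1, e2]
        have i1 := mul_le_mul_of_nonneg_left (ih hl.2 (j + 1)) (pow_nonneg h0 (j + 1))
        have i2 := ih hl.2 j
        refine (add_le_add i1 i2).trans_eq ?_
        rw [Finset.prod_range_succ]
        have := (hpos j).ne'
        field_simp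
        ring
      · intro S hS S' hS' h
        rw [Finset.mem_coe, Finset.mem_powersetCard] at hS hS'
        rw [← Finset.erase_insert (fun h => hv (hS.1 h)), h,
          Finset.erase_insert (fun h => hv (hS'.1 h))]
      · rw [Finset.disjoint_left]
        intro S hS hS'
        rw [Finset.mem_image] at hS'
        obtain ⟨S', -, rfl⟩ := hS'
        exact hv ((Finset.mem_powersetCard.mp hS).1 (Finset.mem_insert_self _ _))

/-- Every set in `𝓕` has weight at least `exp (-t K)` in the generating function at `q = exp (-t)`.
The factor `l.length + 1` counts the possible sizes of a subset. -/
theorem card_le_of_inversions_le {l : List ℕ} (hl : l.Nodup) {𝓕 : Finset (Finset ℕ)} {K : ℕ}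
    (hsub : ∀ S ∈ 𝓕, S ⊆ l.toFinset) (hK : ∀ S ∈ 𝓕, inversions l S ≤ K) {t : ℝ} (ht : 0 < t) :
    (𝓕.card : ℝ) ≤ (l.length + 1) * Real.exp (t * K + Real.pi ^ 2 / (6 * t)) := by
  have hq0 : 0 < Real.exp (-t) := Real.exp_pos _
  have hq1 : Real.exp (-t) < 1 := by rw [Real.exp_lt_one_iff]; linarith
  have h1 : (𝓕.card : ℝ) * Real.exp (-(t * K)) ≤
      ∑ S ∈ l.toFinset.powerset, Real.exp (-t) ^ inversions l S := by
    refine le_trans ?_ (Finset.sum_le_sum_of_subset_of_nonneg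
      (fun S hS => Finset.mem_powerset.mpr (hsub S hS)) fun _ _ _ => by positivity)
    rw [← nsmul_eq_mul]
    refine Finset.card_nsmul_le_sum _ _ _ fun S hS => ?_
    have h2 : Real.exp (-(t * K)) = Real.exp (-t) ^ K := by
      rw [← Real.exp_nat_mul]; ring_nf
    rw [h2]
    exact pow_le_pow_of_le_one hq0.le hq1.le (hK S hS)
  have h2 : ∑ S ∈ l.toFinset.powerset, Real.exp (-t) ^ inversions l S ≤
      (l.length + 1) * Real.exp (Real.pi ^ 2 / (6 * t)) := by
    rw [Finset.sum_powerset]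
    refine (Finset.sum_le_card_nsmul _ _ (Real.exp (Real.pi ^ 2 / (6 * t))) fun j _ =>
      (sum_powersetCard_pow_inversions_le hq0.le hq1 l hl j).trans
        (prod_inv_one_sub_pow_le ht j)).trans_eq ?_
    rw [Finset.card_range, List.toFinset_card_of_nodup hl, nsmul_eq_mul]
    push_cast
    ring
  have h3 := h1.trans h2
  rw [Real.exp_neg, ← div_eq_mul_inv, div_le_iff₀ (Real.exp_pos _)] at h3
  rw [Real.exp_add]
  linarith

/-! ### From cheap sets to few inversions. -/

/-- The number of arcs of the list that go backwards. -/
def backArcs (a : ℕ → ℕ → ℕ) : List ℕ → ℕ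
  | [] => 0
  | v :: l => backArcs a l + ∑ y ∈ l.toFinset, a y v

/-- The number of arcs in `s` from outside `S` into `S`. -/
def cut (a : ℕ → ℕ → ℕ) (s S : Finset ℕ) : ℕ := ∑ x ∈ s ∩ S, ∑ y ∈ s \ S, a y x

/-- An inversion `(v, x)` has `v ∉ S` before `x ∈ S`. One of the two arcs between them is present:
`(x, v)` goes backwards in the list, and `(v, x)` enters `S`. -/
theorem inversions_le {a : ℕ → ℕ → ℕ} (S : Finset ℕ) : ∀ (l : List ℕ), l.Nodup →
    (∀ v ∈ l, ∀ w ∈ l, v ≠ w → 1 ≤ a v w + a w v) →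
    inversions l S ≤ backArcs a l + cut a l.toFinset S := by
  intro l
  induction l with
  | nil => intro _ _; exact Nat.zero_le _
  | cons v l ih =>
    intro hl ha
    rw [List.nodup_cons] at hl
    have ih := ih hl.2 fun x hx y hy => ha x (List.mem_cons_of_mem _ hx) y (List.mem_cons_of_mem _ hy)
    have hv : v ∉ l.toFinset := by simpa using hl.1
    rw [inversions, backArcs, List.toFinset_cons]
    split_ifs with hvS
    · have : cut a l.toFinset S ≤ cut a (insert v l.toFinset) S := by
        unfold cut
        rw [Finset.insert_sdiff_of_mem _ hvS]
        exact Finset.sum_le_sum_of_subset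
          (Finset.inter_subset_inter_right (Finset.subset_insert _ _))
      omega
    · have h1 : cut a (insert v l.toFinset) S =
          ∑ x ∈ l.toFinset ∩ S, a v x + cut a l.toFinset S := by
        unfold cut
        rw [Finset.insert_inter_of_notMem hvS, Finset.insert_sdiff_of_notMem _ hvS,
          ← Finset.sum_add_distrib]
        refine Finset.sum_congr rfl fun x _ => ?_
        rw [Finset.sum_insert fun h => hv (Finset.mem_sdiff.mp h).1]
      have h2 : (l.toFinset ∩ S).card ≤ ∑ x ∈ l.toFinset ∩ S, (a x v + a v x) := by
        rw [Finset.card_eq_sum_ones]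
        refine Finset.sum_le_sum fun x hx => ?_
        have hx : x ∈ l := by simpa using (Finset.mem_inter.mp hx).1
        exact ha x (List.mem_cons_of_mem _ hx) v List.mem_cons_self
          fun h => hl.1 (h ▸ hx)
      have h3 : ∑ x ∈ l.toFinset ∩ S, a x v ≤ ∑ x ∈ l.toFinset, a x v :=
        Finset.sum_le_sum_of_subset Finset.inter_subset_left
      rw [Finset.sum_add_distrib] at h2
      omega

/-- The set of vertices less than `m` with mask `X`. -/
def bits (m X : ℕ) : Finset ℕ := (Finset.range m).filter fun y => X.testBit y = true

theorem inArcs_eq_sum (a : ℕ → ℕ → ℕ) (m v X : ℕ) :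
    inArcs a m v X = ∑ y ∈ Finset.range m \ bits m X, a y v := by
  have : Finset.range m \ bits m X = (Finset.range m).filter fun y => ¬ X.testBit y = true := by
    ext y; simp [bits]; tauto
  rw [this, inArcs, Finset.sum_filter]
  refine Finset.sum_congr rfl fun y _ => ?_
  split_ifs <;> simp_all

theorem bits_sub {m X v : ℕ} (hv : X.testBit v = true) :
    bits m (X - 2 ^ v) = (bits m X).erase v := by
  ext y
  simp [bits, Nat.testBit_sub_two_pow hv]
  tauto

/-- An arc entering the set either enters its last vertex, and is paid for by `inArcs`, or also
enters the set without that vertex. -/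
theorem Cost.cut_le {a : ℕ → ℕ → ℕ} {m X c : ℕ} (h : Cost a m X c) :
    cut a (Finset.range m) (bits m X) ≤ c := by
  induction h with
  | zero => simp [cut, bits]
  | @step X v c hv _ ih =>
    have hsub : bits m X ⊆ Finset.range m := Finset.filter_subset _ _
    unfold cut at ih ⊢
    rw [bits_sub hv, Finset.inter_eq_right.mpr ((Finset.erase_subset _ _).trans hsub)] at ih
    rw [Finset.inter_eq_right.mpr hsub]
    have h1 : ∑ x ∈ (bits m X).erase v, ∑ y ∈ Finset.range m \ bits m X, a y x ≤
        ∑ x ∈ (bits m X).erase v, ∑ y ∈ Finset.range m \ (bits m X).erase v, a y x :=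
      Finset.sum_le_sum fun x _ => Finset.sum_le_sum_of_subset
        (Finset.sdiff_subset_sdiff le_rfl (Finset.erase_subset _ _))
    rw [inArcs_eq_sum]
    by_cases hvm : v ∈ bits m X
    · rw [← Finset.sum_erase_add _ _ hvm]; omega
    · rw [Finset.erase_eq_of_notMem hvm] at ih; omega

/-- A derivation of `Cost` removes vertices from the end, so the ordering is built from its tail:
`l` lists the vertices outside `X`, and prepending `v` adds exactly `inArcs a m v X` backward arcs.
-/
theorem Cost.exists_list {a : ℕ → ℕ → ℕ} {m X c : ℕ} (h : Cost a m X c) :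
    X < 2 ^ m → ∀ l : List ℕ, l.Nodup → l.toFinset = Finset.range m \ bits m X →
      ∃ l' : List ℕ, l'.Nodup ∧ l'.toFinset = Finset.range m ∧
        backArcs a l' ≤ c + backArcs a l := by
  induction h with
  | zero => exact fun _ l hl hX => ⟨l, hl, by simpa [bits] using hX, by omega⟩
  | @step X v c hv _ ih =>
    intro hX l hl hlX
    have hvm := Nat.lt_of_testBit_of_lt hv hX
    have hvb : v ∈ bits m X := by simp [bits, hv, hvm]
    obtain ⟨l', h1, h2, h3⟩ := ih ((Nat.sub_le _ _).trans_lt hX) (v :: l)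
      (List.nodup_cons.mpr ⟨fun h => by
        rw [← List.mem_toFinset, hlX, Finset.mem_sdiff] at h
        exact h.2 hvb, hl⟩) (by
        rw [List.toFinset_cons, hlX, bits_sub hv,
          Finset.sdiff_erase (Finset.mem_range.mpr hvm)])
    refine ⟨l', h1, h2, ?_⟩
    rw [backArcs, hlX, ← inArcs_eq_sum] at h3
    omega

/-- The cheap full set supplies the reference ordering, with respect to which every listed set has
at most `2 * k` inversions. The factor `3` is needed only for `k = 0`. -/
theorem Listed.length_le_exp {a : ℕ → ℕ → ℕ} {n k m N : ℕ} {F L : ℕ → ℕ}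
    (h : Listed a n k m N F L) (hfull : Cheap a m k (2 ^ m - 1))
    (ha : ∀ v < m, ∀ w < m, v ≠ w → 1 ≤ a v w + a w v) :
    (N : ℝ) ≤ 3 * ((m + 1) * Real.exp (Real.pi * √(2 / 3) * √(2 * (k : ℝ)))) := by
  obtain ⟨c, hc, hcost⟩ := hfull
  have h2m := Nat.two_pow_pos m
  obtain ⟨l, hl, hlm, hback⟩ := hcost.exists_list (by omega) [] List.nodup_nil (by
    have : bits m (2 ^ m - 1) = Finset.range m :=
      Finset.filter_true_of_mem fun y hy => by simpa using hy
    simp [this])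
  have hinj : Set.InjOn (fun j => bits m (L j)) (Finset.range N : Set ℕ) := by
    intro i hi j hj hij
    rw [Finset.mem_coe, Finset.mem_range] at hi hj
    have hL : L i = L j := by
      refine Nat.eq_of_testBit_eq fun y => ?_
      have hy := congrArg (y ∈ ·) hij
      by_cases hym : y < m
      · simp only [bits, Finset.mem_filter, Finset.mem_range, hym, true_and, eq_iff_iff] at hy
        exact Bool.eq_iff_iff.mpr hy
      · have h2 : 2 ^ m ≤ 2 ^ y := Nat.pow_le_pow_right (by norm_num) (not_lt.mp hym)
        rw [Nat.testBit_lt_two_pow ((h.lt i hi).trans_le h2),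
          Nat.testBit_lt_two_pow ((h.lt j hj).trans_le h2)]
    rcases lt_trichotomy i j with hlt | heq | hlt
    · have := h.increasing i j hlt hj; omega
    · exact heq
    · have := h.increasing j i hlt hi; omega
  have hcard : ((Finset.range N).image fun j => bits m (L j)).card = N := by
    rw [Finset.card_image_of_injOn hinj, Finset.card_range]
  have hlen : l.length = m := by
    rw [← List.toFinset_card_of_nodup hl, hlm, Finset.card_range]
  have hinv : ∀ S ∈ (Finset.range N).image fun j => bits m (L j), inversions l S ≤ 2 * k := by
    intro S hS
    obtain ⟨j, hj, rfl⟩ := Finset.mem_image.mp hS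
    obtain ⟨c', hc', hcost'⟩ := h.cheap j (Finset.mem_range.mp hj)
    have h1 := inversions_le (a := a) (bits m (L j)) l hl fun v hv w hw => by
      rw [← List.mem_toFinset, hlm, Finset.mem_range] at hv hw
      exact ha v hv w hw
    have h2 := hcost'.cut_le
    rw [hlm] at h1
    simp only [backArcs] at hback
    omega
  have hsub : ∀ S ∈ (Finset.range N).image fun j => bits m (L j), S ⊆ l.toFinset := by
    intro S hS
    obtain ⟨j, hj, rfl⟩ := Finset.mem_image.mp hS
    rw [hlm]
    exact Finset.filter_subset _ _
  have key := fun t ht => card_le_of_inversions_le hl hsub hinv (t := t) ht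
  simp only [hcard, hlen] at key
  have hpi := Real.pi_pos
  rcases Nat.eq_zero_or_pos k with rfl | hk
  -- With `K = 0` the exponent has no minimizer; this `t` makes it `1`, and `exp 1 ≤ 3`.
  · have := key (Real.pi ^ 2 / 6) (by positivity)
    have e1 : Real.pi ^ 2 / 6 * ((2 * 0 : ℕ) : ℝ) + Real.pi ^ 2 / (6 * (Real.pi ^ 2 / 6)) = 1 := by
      field_simp; simp
    rw [e1] at this
    simp only [Nat.cast_zero, mul_zero, Real.sqrt_zero, Real.exp_zero, mul_one]
    have h3 : Real.exp 1 ≤ 3 := by linarith [Real.exp_one_lt_d9]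
    refine this.trans ?_
    rw [mul_comm 3]
    exact mul_le_mul_of_nonneg_left h3 (by positivity)
  · have hr : 0 < √(2 * (k : ℝ)) := Real.sqrt_pos.mpr (by positivity)
    have hr2 : √(2 * (k : ℝ)) ^ 2 = 2 * k := Real.sq_sqrt (by positivity)
    have h6 : 0 < √(2 / 3 : ℝ) := Real.sqrt_pos.mpr (by norm_num)
    have h62 : √(2 / 3 : ℝ) ^ 2 = 2 / 3 := Real.sq_sqrt (by norm_num)
    set r := √(2 * (k : ℝ)) with hrdef
    set g := √(2 / 3 : ℝ) with hgdef
    -- The minimizer `π / √(6K)` of `t * K + π² / (6t)` for `K = 2k = r ^ 2`; both summands become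
    -- `π * g * r / 2`.
    have := key (Real.pi * g / (2 * r)) (by positivity)
    have e1 : Real.pi * g / (2 * r) * ((2 * k : ℕ) : ℝ) +
        Real.pi ^ 2 / (6 * (Real.pi * g / (2 * r))) = Real.pi * g * r := by
      push_cast
      rw [← hr2]
      field_simp
      rw [h62]
      ring
    rw [e1] at this
    have : 0 ≤ ((m : ℝ) + 1) * Real.exp (Real.pi * g * r) := by positivity
    linarith

end FeedbackArcs

/-! ## Feedback arc sets and orderings -/

namespace FeedbackArcs
open RAM

/-- `a` is the adjacency matrix of `T`. -/
def IsMatrixOf {n : ℕ} (T : Digraph (Fin n)) (a : ℕ → ℕ → ℕ) : Prop :=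
  (∀ y v, a y v ≤ 1) ∧ ∀ i j : Fin n, a i j = 1 ↔ T.Adj i j

variable {n : ℕ} {T : Digraph (Fin n)} {F : Finset (Fin n × Fin n)} {a : ℕ → ℕ → ℕ}

/-- On a finite vertex set, reversed reachability in an acyclic digraph is transitive and
irreflexive, hence well-founded; a minimal element of the set is a sink in it. -/
theorem exists_sink (hT : T.IsAcyclic) {X : ℕ} (hX : ∃ v : Fin n, X.testBit v = true) :
    ∃ v : Fin n, X.testBit v = true ∧ ∀ w : Fin n, X.testBit w = true → ¬ T.Adj v w := by
  have hwf : WellFounded (fun v w => Relation.TransGen T.Adj w v) := by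
    have : IsTrans (Fin n) (fun v w => Relation.TransGen T.Adj w v) :=
      ⟨fun _ _ _ h1 h2 => h2.trans h1⟩
    have : Std.Irrefl (fun v w => Relation.TransGen T.Adj w v) := ⟨hT⟩
    exact Finite.wellFounded_of_trans_of_irrefl _
  obtain ⟨v, hv, hmin⟩ := hwf.has_min {v : Fin n | X.testBit v = true} hX
  exact ⟨v, hv, fun w hw h => hmin w hw (.single h)⟩

theorem inArcs_le_card (ha : IsMatrixOf T a) {X : ℕ} (v : Fin n)
    (hX : ∀ y : Fin n, T.Adj y v → (y, v) ∉ F → X.testBit y = true) :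
    inArcs a n v X ≤ (F.filter fun e => e.2 = v).card := by
  have h1 : inArcs a n v X ≤ (Finset.univ.filter fun y : Fin n => (y, v) ∈ F).card := by
    rw [inArcs, Finset.sum_range, Finset.card_filter]
    refine Finset.sum_le_sum fun y _ => ?_
    split_ifs with hy hF hF
    · exact Nat.zero_le _
    · exact le_rfl
    · exact ha.1 _ _
    · have := ha.1 y v
      by_contra hne
      exact hy (hX y ((ha.2 y v).mp (by omega)) hF)
  refine h1.trans (Finset.card_le_card_of_injOn (fun y => (y, v)) ?_ ?_)
  · intro y hy
    simpa using hy
  · intro y _ y' _ h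
    exact (Prod.mk.inj h).1

/-- For a set closed under predecessors in `T` without `F`, put a sink of the set last. All arcs
into it from outside the set lie in `F`, so they are charged to the arcs of `F` with that head, and
different vertices charge different arcs. Removing a sink preserves closedness. -/
theorem cost_of_closed (ha : IsMatrixOf T a) (hF : (T.deleteArcs F).IsAcyclic) (X : ℕ) :
    X < 2 ^ n →
    (∀ y v : Fin n, (T.deleteArcs F).Adj y v → X.testBit v = true → X.testBit y = true) →
    ∃ c, Cost a n X c ∧ c ≤ (F.filter fun e => X.testBit e.2 = true).card := by
  induction X using Nat.strong_induction_on with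
  | _ X ih =>
    intro hX hcl
    by_cases h0 : X = 0
    · subst h0; exact ⟨0, .zero, Nat.zero_le _⟩
    obtain ⟨u, hu⟩ := Nat.exists_testBit_of_ne_zero h0
    obtain ⟨v, hv, hsink⟩ := exists_sink hF ⟨⟨u, Nat.lt_of_testBit_of_lt hu hX⟩, hu⟩
    have hle := Nat.ge_two_pow_of_testBit hv
    have hpos := Nat.two_pow_pos v
    obtain ⟨c, hc, hcard⟩ := ih (X - 2 ^ (v : ℕ)) (by omega) ((Nat.sub_le _ _).trans_lt hX) (by
      intro y w hyw hw
      rw [Nat.testBit_sub_two_pow hv, Bool.and_eq_true] at hw ⊢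
      refine ⟨hcl y w hyw hw.1, ?_⟩
      rw [decide_eq_true_iff]
      intro hyv
      rw [Fin.ext hyv] at hyw
      exact hsink w hw.1 hyw)
    refine ⟨_, .step hv hc, ?_⟩
    have h1 := inArcs_le_card (F := F) ha v fun y hy hyF => hcl y v ⟨hy, hyF⟩ hv
    have h2 : (F.filter fun e => (X - 2 ^ (v : ℕ)).testBit e.2 = true).card +
        (F.filter fun e => e.2 = v).card ≤ (F.filter fun e => X.testBit e.2 = true).card := by
      rw [← Finset.card_union_of_disjoint]
      · refine Finset.card_le_card fun e he => ?_
        rw [Finset.mem_union, Finset.mem_filter, Finset.mem_filter,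
          Nat.testBit_sub_two_pow hv, Bool.and_eq_true] at he
        rw [Finset.mem_filter]
        rcases he with he | ⟨he, hev⟩
        · exact ⟨he.1, he.2.1⟩
        · exact ⟨he, hev ▸ hv⟩
      · rw [Finset.disjoint_left]
        intro e he he'
        rw [Finset.mem_filter, Nat.testBit_sub_two_pow hv] at he
        simp [(Finset.mem_filter.mp he').2] at he
    omega

theorem cheap_of_isFeedbackArcSet (ha : IsMatrixOf T a) (hF : T.IsFeedbackArcSet F) {k : ℕ}
    (hk : F.card ≤ k) : Cheap a n k (2 ^ n - 1) := by
  have := Nat.two_pow_pos n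
  obtain ⟨c, hc, hcard⟩ := cost_of_closed ha hF.2 (2 ^ n - 1) (by omega) fun y v _ _ => by simp
  exact ⟨c, (hcard.trans (Finset.card_filter_le _ _)).trans hk, hc⟩

theorem matrix_fin (s : State) (i j : Fin n) : matrix n s i j = s.mem (i * n + j) := by
  unfold matrix
  rw [if_pos (index_lt i.2 j.2)]

/-- The rank `ρ` strictly increases along every arc that is not output, so no cycle avoids the
output. -/
theorem isFeedbackArcSet_outputArcs (ha : IsMatrixOf T a) {s : State} {ρ : ℕ → ℕ}
    (h : Reduced a n 0 (matrix n s) ρ) : T.IsFeedbackArcSet (outputArcs n s) := by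
  constructor
  · intro e he
    rw [outputArcs, Finset.mem_filter, ← matrix_fin] at he
    have h1 := h.le e.1 e.1.2 e.2 e.2.2
    have h2 := ha.1 e.1 e.2
    exact (ha.2 _ _).mp (by omega)
  · have key : ∀ v w, Relation.TransGen (T.deleteArcs (outputArcs n s)).Adj v w → ρ v < ρ w := by
      intro v w hvw
      have hstep : ∀ v w : Fin n, (T.deleteArcs (outputArcs n s)).Adj v w → ρ v < ρ w := by
        rintro v w ⟨hadj, hout⟩
        rcases h.rank w w.2 (by simp) v v.2 ((ha.2 v w).mpr hadj) with h1 | h1 | h1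
        · rw [matrix_fin] at h1
          exact absurd (by simpa [outputArcs] using h1) hout
        · simp at h1
        · exact h1
      induction hvw with
      | single h => exact hstep _ _ h
      | tail _ h ih => exact ih.trans (hstep _ _ h)
    exact fun v hv => lt_irrefl _ (key v v hv)

theorem card_outputArcs_le (s : State) :
    (outputArcs n s).card ≤ outsideArcs (matrix n s) n 0 := by
  have h1 : outsideArcs (matrix n s) n 0 = ∑ v : Fin n, ∑ y : Fin n, matrix n s y v := by
    unfold outsideArcs
    rw [Finset.sum_range]
    refine Finset.sum_congr rfl fun v _ => ?_
    simp [Finset.sum_range]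
  rw [h1, Finset.sum_comm, ← Finset.sum_product', outputArcs, Finset.card_filter]
  refine Finset.sum_le_sum fun e _ => ?_
  rw [matrix_fin]
  split_ifs <;> omega

theorem card_le_mul_self (F : Finset (Fin n × Fin n)) : F.card ≤ n * n := by
  simpa using Finset.card_le_univ F

/-! ### The initial memory as an adjacency matrix. -/

theorem input_mem_le (T : Digraph (Fin n)) (k x : ℕ) : (input T k).mem x ≤ 1 := by
  unfold input
  dsimp only
  split_ifs <;> omega

theorem input_mem_of_le (T : Digraph (Fin n)) (k : ℕ) {x : ℕ} (hx : n * n ≤ x) :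
    (input T k).mem x = 0 := by
  unfold input
  refine if_neg ?_
  rintro ⟨i, j, rfl, -⟩
  have := index_lt i.2 j.2
  omega

theorem isMatrixOf_input (T : Digraph (Fin n)) (k : ℕ) : IsMatrixOf T (matrix n (input T k)) := by
  constructor
  · intro y v
    unfold matrix
    split_ifs
    · exact input_mem_le T k _
    · exact Nat.zero_le _
  · intro i j
    rw [matrix_fin]
    unfold input
    dsimp only
    constructor
    · intro h
      split_ifs at h with hc
      · obtain ⟨i', j', he, hadj⟩ := hc
        obtain ⟨h1, h2⟩ := index_inj j.2 j'.2 he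
        rwa [Fin.ext h1, Fin.ext h2]
    · exact fun h => if_pos ⟨i, j, rfl, h⟩

end FeedbackArcs

/-! ## The whole program -/

namespace FeedbackArcs
open RAM

/-- Replaces `k` by the minimum of `k` and `n * n`. -/
def clampProg : Prog :=
  .seq (ops [.const 5 1])
    (.seq (.loop 10 0 (ops [.add 2 2 0, .add 10 10 5])) (.ite 2 1 (ops [.copy 1 2]) .skip))

/-- No set of arcs has more than `n * n` elements, so a larger `k` is irrelevant. After clamping,
all numbers are bounded in terms of `n` alone; only this phase runs under a bound that involves `k`.
-/
theorem reaches_clampProg {n : ℕ} (T : Digraph (Fin n)) (k : ℕ) :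
    Reaches (bound n + k) clampProg (input T k) (4 * n + 6) (fun s =>
      s.mem = (input T k).mem ∧ s.reg 0 = n ∧ s.reg 1 = min k (n * n) ∧ s.reg 2 = n * n ∧
      s.reg 5 = 1 ∧ s.reg 6 = 0 ∧ ∀ r, s.reg r ≤ bound n) := by
  have h2n := Nat.two_pow_pos n
  let I : ℕ → State → Prop := fun i s => s.mem = (input T k).mem ∧ s.reg 0 = n ∧ s.reg 1 = k ∧
    s.reg 5 = 1 ∧ s.reg 6 = 0 ∧ (∀ r, r ≠ 1 → s.reg r ≤ bound n) ∧
    ∃ j, i + j = n ∧ s.reg 10 = j ∧ s.reg 2 = j * n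
  refine (Reaches.seq (Reaches.ops (Q := I n) ?_ ?_)
    ((fun s hs => Reaches.seq (R := I 0) (Reaches.loop I 3 ?_ ?_ n s hs) (u := 3) ?_))).mono ?_
    fun _ h => h
  · simp [FitsAll, Instr.Fits, bound]; omega
  · refine ⟨rfl, rfl, rfl, ?_, ?_, fun r hr => ?_, 0, rfl, ?_, ?_⟩
    · simp [execs, Instr.exec]
    · simp [execs, Instr.exec, input]
    · simp only [execs, Instr.exec, input, Function.update_apply, bound]
      split_ifs <;> omega
    all_goals simp [execs, Instr.exec, input]
  · rintro i s ⟨hm, h0, h1, h5, h6, hb, j, hij, h10, h2⟩ hlt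
    rw [h10, h0] at hlt
    have hjn : (j + 1) * n ≤ n * n := Nat.mul_le_mul_right n hlt
    have e : (j + 1) * n = j * n + n := by rw [add_mul, one_mul]
    refine ⟨i - 1, by omega, Reaches.ops ?_ ⟨hm, ?_, ?_, ?_, ?_, fun r hr => ?_,
      j + 1, by omega, ?_, ?_⟩⟩
    · simp [FitsAll, Instr.Fits, Instr.exec, h0, h2, h5, h10, bound]; omega
    all_goals simp [execs, Instr.exec, h0, h1, h2, h5, h6, h10, e]
    have := hb r hr
    simp only [Function.update_apply]
    unfold bound at this ⊢
    split_ifs <;> omega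
  · rintro i s ⟨hm, h0, h1, h5, h6, hb, j, hij, h10, h2⟩ hle
    rw [h10, h0] at hle
    exact ⟨hm, h0, h1, h5, h6, hb, j, by omega, h10, h2⟩
  · rintro s ⟨hm, h0, h1, h5, h6, hb, j, hij, h10, h2⟩
    obtain rfl : j = n := by omega
    refine Reaches.ite (fun hlt => ?_) (fun hle => ?_)
    · rw [h1, h2] at hlt
      refine Reaches.ops (by simp [FitsAll, Instr.Fits]) ⟨hm, ?_, ?_, ?_, ?_, ?_, fun r => ?_⟩
      all_goals simp [execs, Instr.exec, h0, h2, h5, h6]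
      · omega
      · have := hb r
        simp only [Function.update_apply]
        unfold bound at this ⊢
        split_ifs with hr
        · omega
        · exact this hr
    · rw [h1, h2] at hle
      refine (Reaches.skip ⟨hm, h0, by rw [h1]; omega, h2, h5, h6, fun r => ?_⟩).mono
        (t := 1) (by omega) fun _ h => h
      by_cases hr : r = 1
      · rw [hr, h1]; unfold bound; omega
      · exact hb r hr
  · simp; omega

/-- Stores the powers of two and initializes the main loop. -/
def setupProg : Prog :=
  .seq (ops [.const 10 0, .const 14 1, .add 12 0 5])
    (.seq (.loop 10 12 (ops [.add 18 2 10, .store 18 14, .add 14 14 14, .add 10 10 5]))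
      (ops [.load 19 18, .const 10 0, .const 11 0, .add 4 18 5, .add 3 4 19, .copy 12 0,
        .const 13 1, .store 4 5]))

/-- Powers of two come from repeated doubling. Register 18 ends at the address of `2 ^ n`, from
which both table addresses are derived. The initial list consists of the empty set, whose mask `0`
is already in memory; only its value `1` has to be stored. -/
theorem reaches_setupProg {n k : ℕ} {s : State} (h0 : s.reg 0 = n) (h1 : s.reg 1 = k)
    (hk : k ≤ n * n) (h2 : s.reg 2 = n * n) (h5 : s.reg 5 = 1) (h6 : s.reg 6 = 0)
    (hle : ∀ x, s.mem x ≤ 1) (hz : ∀ x, n * n ≤ x → s.mem x = 0) :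
    Reaches (bound n) setupProg s (6 * n + 20) (fun s' => Layout n k s' ∧
      (∀ x < n * n, s'.mem x = s.mem x) ∧ s'.reg 10 = 0 ∧ s'.reg 11 = 0 ∧ s'.reg 12 = n ∧
      s'.reg 13 = 1 ∧ Listed (matrix n s) n k 0 1 (table n s') (listing n s')) := by
  have h2n := Nat.two_pow_pos n
  let I : ℕ → State → Prop := fun i s' => (∀ r < 10, s'.reg r = s.reg r) ∧ s'.reg 12 = n + 1 ∧
    (∀ x < n * n, s'.mem x = s.mem x) ∧ (∀ x, n * n + n < x → s'.mem x = 0) ∧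
    ∃ j, i + j = n + 1 ∧ s'.reg 10 = j ∧ s'.reg 14 = 2 ^ j ∧
      (∀ v < j, s'.mem (n * n + v) = 2 ^ v) ∧ (0 < j → s'.reg 18 + 1 = n * n + j)
  refine (Reaches.seq (Reaches.ops (Q := I (n + 1)) ?_ ?_)
    ((fun s hs => Reaches.seq (R := I 0) (Reaches.loop I 5 ?_ ?_ (n + 1) s hs) (u := 9) ?_))).mono
    ?_ fun _ h => h
  · simp [FitsAll, Instr.Fits, Instr.exec, h0, h5, bound]; omega
  · refine ⟨fun r hr => ?_, ?_, fun x _ => rfl, fun x hx => hz x (by omega), 0, rfl, ?_, ?_,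
      by omega, by omega⟩
    · simp (disch := omega) [execs, Instr.exec, Function.update_of_ne]
    all_goals simp [execs, Instr.exec, h0, h5]
  · rintro i s' ⟨hr, h12, hm, hm0, j, hij, h10, h14, hp, h18⟩ hlt
    rw [h10, h12] at hlt
    have g2 : s'.reg 2 = n * n := (hr 2 (by norm_num)).trans h2
    have g5 : s'.reg 5 = 1 := (hr 5 (by norm_num)).trans h5
    have hpj : 2 ^ j ≤ 2 ^ n := Nat.pow_le_pow_right (by norm_num) (by omega)
    refine ⟨i - 1, by omega, Reaches.ops ?_ ⟨fun r hr' => ?_, ?_, fun x hx => ?_, fun x hx => ?_,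
      j + 1, by omega, ?_, ?_, fun v hv => ?_, fun _ => ?_⟩⟩
    · simp [FitsAll, Instr.Fits, Instr.exec, g2, g5, h10, h14, bound]; omega
    · simp (disch := omega) [execs, Instr.exec, Function.update_of_ne, hr r hr']
    · simp [execs, Instr.exec, h12]
    · simp [execs, Instr.exec, g2, h10, h14]
      rw [Function.update_of_ne (by omega)]; exact hm x hx
    · simp [execs, Instr.exec, g2, h10, h14]
      rw [Function.update_of_ne (by omega)]; exact hm0 x hx
    · simp [execs, Instr.exec, g5, h10]
    · simp [execs, Instr.exec, h14, pow_succ, mul_two]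
    · simp [execs, Instr.exec, g2, h10, h14, Function.update_apply]
      split_ifs with hvj
      · rw [hvj]
      · exact hp v (by omega)
    · simp [execs, Instr.exec, g2, h10]; omega
  · rintro i s' ⟨hr, h12, hm, hm0, j, hij, h10, h14, hp, h18⟩ hle
    rw [h10, h12] at hle
    exact ⟨hr, h12, hm, hm0, j, by omega, h10, h14, hp, h18⟩
  · rintro s' ⟨hr, h12, hm, hm0, j, hij, h10, h14, hp, h18⟩
    obtain rfl : j = n + 1 := by omega
    have g18 : s'.reg 18 = n * n + n := by have := h18 (by omega); omega
    have g5 : s'.reg 5 = 1 := (hr 5 (by norm_num)).trans h5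
    have g0 : s'.reg 0 = n := (hr 0 (by norm_num)).trans h0
    have hpn : s'.mem (n * n + n) = 2 ^ n := hp n (by omega)
    have hmem : (execs [.load 19 18, .const 10 0, .const 11 0, .add 4 18 5, .add 3 4 19,
        .copy 12 0, .const 13 1, .store 4 5] s').mem
        = Function.update s'.mem (tableStart n) 1 := by
      simp [execs, Instr.exec, g18, g5, tableStart]
    refine Reaches.ops ?_ ⟨⟨?_, ?_, ?_, ?_, ?_, ?_, ?_, hk, fun x hx => ?_, fun v hv => ?_⟩,
      fun x hx => ?_, ?_, ?_, ?_, ?_, listed_zero ?_ (fun Z hZ => ?_) ?_⟩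
    · simp [FitsAll, Instr.Fits, Instr.exec, g18, g5, hpn, bound]; omega
    · simp [execs, Instr.exec, g0]
    · simp [execs, Instr.exec, hr, h1]
    · simp [execs, Instr.exec, hr, h2]
    · simp [execs, Instr.exec, g18, g5, hpn, listStart]
    · simp [execs, Instr.exec, g18, g5, tableStart]
    · simp [execs, Instr.exec, g5]
    · simp [execs, Instr.exec, hr, h6]
    · rw [hmem, Function.update_of_ne (by unfold tableStart; omega), hm x hx]
      exact hle x
    · rw [hmem, Function.update_of_ne (by unfold tableStart; omega)]
      exact hp v (by omega)
    · rw [hmem, Function.update_of_ne (by unfold tableStart; omega), hm x hx]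
    all_goals try (simp [execs, Instr.exec, g0]; done)
    · rw [table, hmem]; simp
    · rw [table, hmem, Function.update_of_ne (by omega)]
      exact hm0 _ (by unfold tableStart; omega)
    · rw [listing, hmem, Function.update_of_ne (by unfold listStart tableStart; omega)]
      exact hm0 _ (by unfold listStart; omega)
  · simp; omega

/-- The program after the initialization of the constants. -/
def mainProg : Prog :=
  .seq setupProg
    (.seq (.loop 10 12 stageProg)
      (.ite 12 0 (ops [.const 0 0]) (.seq outputProg (ops [.const 0 1]))))

/-- A bound for the number of steps of `mainProg` if all lists have length at most `M`. -/
def mainTime (n M : ℕ) : ℕ := 6 * n + 20 + (n * (stageTime n M + 1) + 1 + (outputTime n + 3))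

theorem reaches_mainProg {n k M : ℕ} {T : Digraph (Fin n)} {s : State} (h0 : s.reg 0 = n)
    (h1 : s.reg 1 = k) (hk : k ≤ n * n) (h2 : s.reg 2 = n * n) (h5 : s.reg 5 = 1)
    (h6 : s.reg 6 = 0) (hle : ∀ x, s.mem x ≤ 1) (hz : ∀ x, n * n ≤ x → s.mem x = 0)
    (hT : IsMatrixOf T (matrix n s)) (hloop : ∀ v, ¬ T.Adj v v)
    (hM : ∀ m ≤ n, Cheap (matrix n s) m k (2 ^ m - 1) → ∀ N F L,
      Listed (matrix n s) n k m N F L → N ≤ M) :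
    Reaches (bound n) mainProg s (mainTime n M) (Answers T k) := by
  have h2n := Nat.two_pow_pos n
  refine (reaches_setupProg h0 h1 hk h2 h5 h6 hle hz).seq ?_
  rintro t ⟨Lt, tm, t10, t11, t12, t13, tL⟩
  have ht : matrix n t = matrix n s := matrix_congr tm
  rw [← ht] at tL hM hT
  refine (reaches_stages Lt t10 t11 t12 t13 tL hM).seq ?_
  rintro q ⟨qm, qr, hq⟩
  have q0 : q.reg 0 = n := (qr 0 (by norm_num)).trans Lt.reg0
  have hqt : matrix n q = matrix n t :=
    matrix_congr fun x hx => qm x (by unfold tableStart; omega)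
  rw [← hqt] at hq hT
  -- Register 12 is `0` after an abort and `n` otherwise; an abort forces `0 < n`, so comparison
  -- with register 0 separates the cases.
  refine Reaches.ite (fun hlt => ?_) (fun hge => ?_)
  · rw [q0] at hlt
    rcases hq with ⟨q12, -⟩ | ⟨q12, hn, hno⟩
    · omega
    · refine (Reaches.ops ?_ (.inr ⟨?_, ?_⟩)).mono (t := 2) (by omega) fun _ h => h
      · simp [FitsAll, Instr.Fits]
      · simp [execs, Instr.exec]
      · rintro ⟨F, hF, hcard⟩
        exact hno (cheap_of_isFeedbackArcSet hT hF hcard)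
  · rw [q0] at hge
    rcases hq with ⟨q12, q10, q11, hc, hval⟩ | ⟨q12, hn, -⟩
    · have Lq := Lt.congr (fun r hr => qr r (by omega)) qm
      have ha0 : ∀ v < n, matrix n q v v = 0 := fun v hv => by
        have h1 := Lq.matrix_le v v
        by_contra hne
        exact hloop ⟨v, hv⟩ ((hT.2 ⟨v, hv⟩ ⟨v, hv⟩).mp (by dsimp only; omega))
      refine (Reaches.seq (reaches_outputProg Lq q10 q11 ha0 hc hval) (u := 2) ?_).mono
        (by omega) fun _ h => h
      rintro p ⟨ρ, hR, hout⟩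
      refine Reaches.ops ?_ (.inl ⟨?_, isFeedbackArcSet_outputArcs hT hR,
        (card_outputArcs_le p).trans hout⟩)
      · simp [FitsAll, Instr.Fits, bound]; omega
      · simp [execs, Instr.exec]
    · omega

end FeedbackArcs

/-! ## The running time -/

namespace FeedbackArcs
open RAM

theorem bound_le (n : ℕ) : bound n ≤ 2 ^ (2 * n + 4) := by
  have h1 : n < 2 ^ n := Nat.lt_two_pow_self
  have h2 : 2 ^ (2 * n + 4) = 16 * (2 ^ n * 2 ^ n) := by
    rw [pow_add, two_mul, pow_add]; ring
  have h3 : n * n ≤ 2 ^ n * 2 ^ n := Nat.mul_le_mul h1.le h1.le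
  have h4 : 2 ^ n ≤ 2 ^ n * 2 ^ n := Nat.le_mul_of_pos_left _ (by positivity)
  have h5 := Nat.two_pow_pos n
  unfold bound
  omega

theorem len_bound_add_le (n k : ℕ) : 2 * len (bound n + k) + 1 ≤ 11 * (n + 1) * (k + 1) := by
  have h1 : bound n + k ≤ 2 ^ (2 * n + 4 + k) := by
    have h2 := bound_le n
    have h3 : k + 1 ≤ 2 ^ k := Nat.lt_two_pow_self
    have h4 : 0 < 2 ^ (2 * n + 4) := by positivity
    rw [pow_add]
    nlinarith
  have h2 := len_mono h1
  have h3 : len (2 ^ (2 * n + 4 + k)) = 2 * n + 4 + k + 1 := by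
    unfold len; rw [Nat.log_pow (by norm_num)]
  nlinarith [Nat.zero_le (n * k)]

theorem mainTime_le (n M : ℕ) : mainTime n M ≤ 400 * (n + 1) ^ 3 * (M + 1) := by
  unfold mainTime stageTime outputTime bestTime
  have : 400 * (n + 1) ^ 3 * (M + 1) = 400 * (n ^ 3 * M) + 1200 * (n ^ 2 * M) + 1200 * (n * M)
      + 400 * M + 400 * n ^ 3 + 1200 * n ^ 2 + 1200 * n + 400 := by ring
  rw [this]
  ring_nf
  nlinarith [Nat.zero_le (n ^ 3 * M)]

end FeedbackArcs

open FeedbackArcs RAM in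
/-- One program decides and solves Feedback Arc Set on all semi-complete digraphs, in time
`exp (C * √(2k)) * n ^ O(1)` with `C = π * √(2/3)`. -/
theorem mainTheorem3 :
    ∃ (P : RAM.Prog) (c : ℕ), ∀ (n : ℕ) (T : Digraph (Fin n)), T.IsSemicomplete → ∀ k : ℕ,
      ∃ (s : RAM.State) (t : ℕ), RAM.Run P (RAM.input T k) s t ∧
        (t : ℝ) ≤ c * Real.exp (Real.pi * √(2 / 3) * √(2 * (k : ℝ))) * ((n : ℝ) + 1) ^ c ∧
        RAM.Answers T k s := by
  -- The same constant is factor and exponent. The factor must cover `66 + 400 * 4 * 11 = 17666`,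
  -- while exponent `5` would suffice.
  refine ⟨.seq clampProg mainProg, 20000, fun n T hT k => ?_⟩
  have h2n := Nat.two_pow_pos n
  have hstart : Bounded (bound n + k) (input T k) := by
    refine ⟨fun r => ?_, fun x => ?_⟩
    · unfold input bound
      dsimp only
      split_ifs <;> omega
    · have := input_mem_le T k x
      unfold bound
      omega
  obtain ⟨s, u, hrun, hu, -, hm, h0, h1, h2, h5, h6, hb⟩ := reaches_clampProg T k hstart
  set k' := min k (n * n) with hk'
  have hmat : matrix n s = matrix n (input T k) := matrix_congr fun x _ => congrFun hm x
  have hmatT : IsMatrixOf T (matrix n s) := hmat ▸ isMatrixOf_input T k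
  have hs : Bounded (bound n) s :=
    ⟨hb, fun x => by rw [hm]; exact (input_mem_le T k x).trans (by unfold bound; omega)⟩
  set E := Real.exp (Real.pi * √(2 / 3) * √(2 * (k : ℝ))) with hE
  -- Absorbs the factor `k + 1` from the bit length of the unclamped `k`, using `1 + x + x² / 2 ≤
  -- exp x`.
  have hE1 : (k : ℝ) + 1 ≤ E := by
    have hx : 0 ≤ Real.pi * √(2 / 3) * √(2 * (k : ℝ)) := by positivity
    have h3 := Real.quadratic_le_exp_of_nonneg hx
    have h4 : (Real.pi * √(2 / 3) * √(2 * (k : ℝ))) ^ 2 = Real.pi ^ 2 * (2 / 3) * (2 * k) := by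
      rw [mul_pow, mul_pow, Real.sq_sqrt (by norm_num), Real.sq_sqrt (by positivity)]
    have h5 : (9 : ℝ) ≤ Real.pi ^ 2 := by nlinarith [Real.pi_gt_three]
    rw [h4] at h3
    nlinarith [mul_le_mul_of_nonneg_right h5 (Nat.cast_nonneg (α := ℝ) k)]
  set M := ⌊3 * (((n : ℝ) + 1) * E)⌋₊ with hMdef
  have hM : ∀ m ≤ n, Cheap (matrix n s) m k' (2 ^ m - 1) → ∀ N F L,
      Listed (matrix n s) n k' m N F L → N ≤ M := by
    intro m hmn hc N F L hL
    refine Nat.le_floor ((hL.length_le_exp hc fun v hv w hw hvw => ?_).trans ?_)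
    -- Here semi-completeness enters, and only for the running time.
    · have hne : (⟨v, by omega⟩ : Fin n) ≠ ⟨w, by omega⟩ := fun h => hvw (Fin.mk.inj_iff.mp h)
      rcases hT.adj_or_adj _ _ hne with h | h
      · have := (hmatT.2 _ _).mpr h
        dsimp only at this
        omega
      · have := (hmatT.2 _ _).mpr h
        dsimp only at this
        omega
    · have hkk : (k' : ℝ) ≤ k := by exact_mod_cast min_le_left _ _
      have hmn' : (m : ℝ) ≤ n := by exact_mod_cast hmn
      have : Real.exp (Real.pi * √(2 / 3) * √(2 * (k' : ℝ))) ≤ E := by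
        rw [hE]; gcongr
      gcongr
  obtain ⟨s', u', hrun', hu', -, hans⟩ := reaches_mainProg h0 h1 (min_le_right _ _) h2 h5 h6
    (fun x => by rw [hm]; exact input_mem_le T k x)
    (fun x hx => by rw [hm]; exact input_mem_of_le T k hx) hmatT hT.loopless hM hs
  refine ⟨s', u + u', .seq hrun hrun', ?_, ?_⟩
  · have hy : (1 : ℝ) ≤ (n : ℝ) + 1 := by linarith [Nat.cast_nonneg (α := ℝ) n]
    set y := (n : ℝ) + 1 with hydef
    have hEpos : 1 ≤ E := by linarith [Nat.cast_nonneg (α := ℝ) k]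
    have hu1 : u ≤ 6 * (n + 1) * (11 * (n + 1) * (k + 1)) :=
      hu.trans (Nat.mul_le_mul (by omega) (len_bound_add_le n k))
    have hu2 : u' ≤ 400 * (n + 1) ^ 3 * (M + 1) * (11 * (n + 1)) :=
      hu'.trans (Nat.mul_le_mul (mainTime_le n M) (by simpa using len_bound_add_le n 0))
    have hM1 : (M : ℝ) + 1 ≤ 4 * (y * E) := by
      have := Nat.floor_le (show 0 ≤ 3 * (y * E) by positivity)
      nlinarith
    have hr1 : (u : ℝ) ≤ 6 * y * (11 * y * E) := by
      have : (u : ℝ) ≤ 6 * y * (11 * y * (k + 1)) := by rw [hydef]; exact_mod_cast hu1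
      refine this.trans ?_
      gcongr
    have hr2 : (u' : ℝ) ≤ 400 * y ^ 3 * (4 * (y * E)) * (11 * y) := by
      have : (u' : ℝ) ≤ 400 * y ^ 3 * (M + 1) * (11 * y) := by rw [hydef]; exact_mod_cast hu2
      refine this.trans ?_
      gcongr
    have hy2 : y ^ 2 ≤ y ^ 20000 := pow_le_pow_right₀ hy (by norm_num)
    have hy5 : y ^ 5 ≤ y ^ 20000 := pow_le_pow_right₀ hy (by norm_num)
    -- Hides the huge power from the arithmetic tactics.
    generalize y ^ 20000 = z at hy2 hy5
    have e1 : E * y ^ 2 ≤ E * z := by gcongr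
    have e2 : E * y ^ 5 ≤ E * z := by gcongr
    push_cast
    nlinarith
  -- An answer for `min k (n * n)` is one for `k`, as every feedback arc set has at most `n * n`
  -- arcs.
  · rcases hans with ⟨h, hF, hcard⟩ | ⟨h, hno⟩
    · exact .inl ⟨h, hF, hcard.trans (min_le_left _ _)⟩
    · exact .inr ⟨h, fun ⟨F, hF, hcard⟩ => hno ⟨F, hF, le_min hcard (card_le_mul_self F)⟩⟩
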